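/- Let $\Phi\subseteq E$ be an irreducible reduced crystallographic root system in a finite-dimensional $\mathbb{Q}$-vector space $E$, with simple roots $\{\alpha_i\}_{i\in I}$, positive roots $\Phi^+$, Weyl group $W$ with simple reflections $s_i$, and weight lattice $\Lambda$ (the $\mathbb{Z}$-span of the fundamental weights). A weight $0\ne\lambda\in\Lambda$ is a *minuscule weight* if it is dominant and $(\lambda,\alpha^\vee)\in\{0,\pm1\}$ for all $\alpha\in\Phi$. Let $\Psi\subseteq\Lambda$ be a non-empty union of $W$-orbits of minuscule weights. For a commutative ring $R$ with $1$ let $M_R$ be the free $R$-module with basis $\{z_\mu\mid\mu\in\Psi\}$, and define $R$-linear maps $e_i,f_i\colon M_R\to M_R$ ($i\in I$) by $e_i(z_\mu)=z_{\mu+\alpha_i}$ if $(\mu,\alpha_i^\vee)=-1$ and $e_i(z_\mu)=0$ otherwise; $f_i(z_\mu)=z_{\mu-\alpha_i}$ if $(\mu,\alpha_i^\vee)=1$ and $f_i(z_\mu)=0$ otherwise. Then $e_i^2=f_i^2=0$. Put $x_i(t)=\mathrm{id}+te_i$, $y_i(t)=\mathrm{id}+tf_i$ ($t\in R$), $n_i=x_i(1)y_i(-1)x_i(1)$,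 and let $G_R(\Psi)=\langle x_i(t),y_i(t)\mid i\in I,\ t\in R\rangle\subseteq \mathrm{GL}(M_R)$. For each $\alpha\in\Phi$ choose, independently of $R$, indices $i,i_1,\dots,i_k\in I$ with $\alpha=s_{i_1}\cdots s_{i_k}(\alpha_i)$, and set $\mathbf{e}_\alpha=n_{i_1}\cdots n_{i_k}\,e_i\,n_{i_k}^{-1}\cdots n_{i_1}^{-1}$. Then $\mathbf{e}_\alpha^2=0$, and $x_\alpha(t):=\mathrm{id}+t\,\mathbf{e}_\alpha\in G_R(\Psi)$ for all $t\in R$. **Proposition.** Let $\alpha,\beta\in\Phi^+$ with $\beta\neq\pm\alpha$. If $\alpha+\beta\notin\Phi$, then $x_\alpha(t)x_\beta(u)=x_\beta(u)x_\alpha(t)$ for every commutative ring $R$ and all $t,u\in R$. If $\alpha+\beta\in\Phi$, then there is a unique scalar $c\in\mathbb{C}$ with $[\mathbf{e}_\alpha,\mathbf{e}_\beta]=c\,\mathbf{e}_{\alpha+\beta}$ over $\mathbb{C}$; it satisfies $c\in\{\pm1,\pm2\}$, and the following hold for every commutative ring $R$ and all $t,u\in R$. (a) If $2\alpha+\beta\notin\Phi$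 and $\alpha+2\beta\notin\Phi$, then $x_\beta(-u)x_\alpha(t)x_\beta(u)=x_\alpha(t)x_{\alpha+\beta}(ctu)$. (b) If $2\alpha+\beta\notin\Phi$ and $\alpha+2\beta\in\Phi$, then $$x_\beta(-u)x_\alpha(t)x_\beta(u)=x_\alpha(t)x_{\alpha+\beta}(ctu)x_{\alpha+2\beta}(-c'tu^2),$$ where the factors on the right-hand side commute with each other and $c'=\pm1$ is the unique complex scalar with $\mathbf{e}_\beta\mathbf{e}_\alpha\mathbf{e}_\beta=c'\mathbf{e}_{\alpha+2\beta}$ over $\mathbb{C}$. (c) If $2\alpha+\beta\in\Phi$, then $\alpha+2\beta\notin\Phi$ and $$x_\beta(-u)x_\alpha(t)x_\beta(u)=x_\alpha(t)x_{\alpha+\beta}(ctu)x_{2\alpha+\beta}(c''t^2u),$$ where $c''=\pm1$ is the unique complex scalar with $\mathbf{e}_\alpha\mathbf{e}_\beta\mathbf{e}_\alpha=c''\mathbf{e}_{2\alpha+\beta}$ over $\mathbb{C}$. -/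

import Mathlib

noncomputable section

namespace MinusculeChevalley

variable {ι E N : Type*} [AddCommGroup E] [Module ℚ E] [AddCommGroup N] [Module ℚ N]
  {P : RootPairing ι ℚ E N} (b : P.Base)

/-- `ϖ` is the fundamental weight attached to the simple root `i`:
`(ϖ, αⱼ^∨) = δᵢⱼ` for all simple roots `αⱼ`. -/
def IsFundamentalWeight (i : b.support) (ϖ : E) : Prop :=
  (P.coroot' i ϖ = 1) ∧ ∀ j : b.support, j ≠ i → P.coroot' j ϖ = 0

/-- The weight lattice: the `ℤ`-span of the fundamental weights. -/
def weightLattice : Submodule ℤ E :=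
  Submodule.span ℤ {ϖ : E | ∃ i : b.support, IsFundamentalWeight b i ϖ}

/-- Minuscule weights: nonzero dominant elements `v` of the weight lattice such that
`(v, α^∨) ∈ {0, ±1}` for every root `α`. -/
structure IsMinuscule (v : E) : Prop where
  mem_weightLattice : v ∈ weightLattice b
  ne_zero : v ≠ 0
  dominant : ∀ i : b.support, 0 ≤ P.coroot' i v
  coroot_mem : ∀ a : ι, P.coroot' a v ∈ ({0, 1, -1} : Set ℚ)

/-- A set `Ψ` of weights which is a non-empty union of Weyl group orbits of minuscule weights. -/
structure MinusculeSet where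
  carrier : Set E
  isUnion : ∃ S : Set E, S.Nonempty ∧ (∀ v ∈ S, IsMinuscule b v) ∧
    carrier = ⋃ v ∈ S, MulAction.orbit P.weylGroup v

namespace MinusculeSet

variable {b} (Ψ : MinusculeSet b)

/-- `Ψ` is stable under the simple reflections. -/
theorem reflection_mem {μ : E} (h : μ ∈ Ψ.carrier) (i : b.support) :
    P.reflection i μ ∈ Ψ.carrier := by
  obtain ⟨S, -, -, hS⟩ := Ψ.isUnion
  rw [hS] at h ⊢
  simp only [Set.mem_iUnion] at h ⊢
  obtain ⟨v, hv, hμ⟩ := h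
  obtain ⟨g, rfl⟩ := hμ
  exact ⟨v, hv, RootPairing.weylGroup.ofIdx P i * g, by
    simp only [mul_smul, RootPairing.weylGroup.ofIdx_smul]; rfl⟩

/-- If `(μ, αᵢ^∨) = -1` then `μ + αᵢ ∈ Ψ`. -/
theorem add_mem {μ : E} (h : μ ∈ Ψ.carrier) (i : b.support) (hi : P.coroot' i μ = -1) :
    μ + P.root i ∈ Ψ.carrier := by
  simpa [RootPairing.reflection_apply, hi] using Ψ.reflection_mem h i

/-- If `(μ, αᵢ^∨) = 1` then `μ - αᵢ ∈ Ψ`. -/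
theorem sub_mem {μ : E} (h : μ ∈ Ψ.carrier) (i : b.support) (hi : P.coroot' i μ = 1) :
    μ - P.root i ∈ Ψ.carrier := by
  simpa [RootPairing.reflection_apply, hi] using Ψ.reflection_mem h i

section Ring

variable (R : Type*) [CommRing R]

/-- The free `R`-module with basis `z_μ` (`μ ∈ Ψ`), where `z_μ = Finsupp.single μ 1`. -/
abbrev FreeMod : Type _ := Ψ.carrier →₀ R

open Classical in
/-- The map `eᵢ`: `z_μ ↦ z_{μ + αᵢ}` if `(μ, αᵢ^∨) = -1`, and `z_μ ↦ 0` otherwise. -/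
def e (i : b.support) : Module.End R (Ψ.FreeMod R) :=
  Finsupp.linearCombination R fun μ : Ψ.carrier =>
    if h : P.coroot' i (μ : E) = -1 then
      Finsupp.single (⟨(μ : E) + P.root i, Ψ.add_mem μ.2 i h⟩ : Ψ.carrier) (1 : R)
    else 0

open Classical in
/-- The map `fᵢ`: `z_μ ↦ z_{μ - αᵢ}` if `(μ, αᵢ^∨) = 1`, and `z_μ ↦ 0` otherwise. -/
def f (i : b.support) : Module.End R (Ψ.FreeMod R) :=
  Finsupp.linearCombination R fun μ : Ψ.carrier =>
    if h : P.coroot' i (μ : E) = 1 then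
      Finsupp.single (⟨(μ : E) - P.root i, Ψ.sub_mem μ.2 i h⟩ : Ψ.carrier) (1 : R)
    else 0

theorem e_mul_e (i : b.support) : Ψ.e R i * Ψ.e R i = 0 := by
  classical
  refine Finsupp.lhom_ext' fun μ => LinearMap.ext_ring ?_
  by_cases h : P.coroot' i (μ : E) = -1
  · have h2 : ¬ P.coroot' i ((μ : E) + P.root i) = -1 := by
      rw [map_add, h]; norm_num
    simp only [e, Module.End.mul_apply, LinearMap.comp_apply, Finsupp.lsingle_apply,
      Finsupp.linearCombination_single, one_smul, dif_pos h, dif_neg h2, LinearMap.zero_apply]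
  · simp only [e, Module.End.mul_apply, LinearMap.comp_apply, Finsupp.lsingle_apply,
      Finsupp.linearCombination_single, one_smul, dif_neg h, map_zero, LinearMap.zero_apply]

theorem f_mul_f (i : b.support) : Ψ.f R i * Ψ.f R i = 0 := by
  classical
  refine Finsupp.lhom_ext' fun μ => LinearMap.ext_ring ?_
  by_cases h : P.coroot' i (μ : E) = 1
  · have h2 : ¬ P.coroot' i ((μ : E) - P.root i) = 1 := by
      rw [map_sub, h]; norm_num
    simp only [f, Module.End.mul_apply, LinearMap.comp_apply, Finsupp.lsingle_apply,
      Finsupp.linearCombination_single, one_smul, dif_pos h, dif_neg h2, LinearMap.zero_apply]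
  · simp only [f, Module.End.mul_apply, LinearMap.comp_apply, Finsupp.lsingle_apply,
      Finsupp.linearCombination_single, one_smul, dif_neg h, map_zero, LinearMap.zero_apply]

end Ring

/-- For `x` with `x² = 0`, the invertible map `id + t x`, with inverse `id - t x`. -/
def unipotent {R : Type*} [CommRing R] {V : Type*} [AddCommGroup V] [Module R V]
    (x : Module.End R V) (hx : x * x = 0) (t : R) : LinearMap.GeneralLinearGroup R V where
  val := 1 + t • x
  inv := 1 - t • x
  val_inv := by simp [mul_sub, add_mul, hx]
  inv_val := by simp [sub_mul, mul_add, hx]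

variable (R : Type*) [CommRing R]

/-- `xᵢ(t) = id + t eᵢ`. -/
def x (i : b.support) (t : R) : LinearMap.GeneralLinearGroup R (Ψ.FreeMod R) :=
  unipotent (Ψ.e R i) (Ψ.e_mul_e R i) t

/-- `yᵢ(t) = id + t fᵢ`. -/
def y (i : b.support) (t : R) : LinearMap.GeneralLinearGroup R (Ψ.FreeMod R) :=
  unipotent (Ψ.f R i) (Ψ.f_mul_f R i) t

/-- The Chevalley group `G_R(Ψ) = ⟨xᵢ(t), yᵢ(t) ∣ i ∈ I, t ∈ R⟩`. -/
def chevalleyGroup : Subgroup (LinearMap.GeneralLinearGroup R (Ψ.FreeMod R)) :=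
  Subgroup.closure {g | ∃ (i : b.support) (t : R), g = Ψ.x R i t ∨ g = Ψ.y R i t}

/-- `nᵢ = xᵢ(1) yᵢ(-1) xᵢ(1)`. -/
def n (i : b.support) : LinearMap.GeneralLinearGroup R (Ψ.FreeMod R) :=
  Ψ.x R i 1 * Ψ.y R i (-1) * Ψ.x R i 1

end MinusculeSet

/-- A choice, for every root `α`, of simple roots `αᵢ` and `αᵢ₁, …, αᵢₖ` such that
`α = sᵢ₁ ⋯ sᵢₖ (αᵢ)`. -/
structure RootWords where
  word : ι → List b.support
  simple : ι → b.support
  root_eq : ∀ a : ι, P.root a =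
    ((word a).map fun j : b.support => P.reflection (j : ι)).prod (P.root (simple a))

namespace MinusculeSet

variable {b} (Ψ : MinusculeSet b) (W : RootWords b) (R : Type*) [CommRing R]

/-- The product `nᵢ₁ ⋯ nᵢₖ` along the word chosen for the root `α`. -/
def nWord (a : ι) : LinearMap.GeneralLinearGroup R (Ψ.FreeMod R) :=
  ((W.word a).map (Ψ.n R)).prod

/-- The root element `𝐞_α = nᵢ₁ ⋯ nᵢₖ eᵢ nᵢₖ⁻¹ ⋯ nᵢ₁⁻¹`. Over `R = ℂ` this is an element of
`𝔤𝔩(M)`. The defining formula makes sense over `ℤ` and is compatible with base change, so that over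
a general ring `R` it is the map induced by `𝐞_α` on `R ⊗ M_ℤ`. -/
def rootVector (a : ι) : Module.End R (Ψ.FreeMod R) :=
  (Ψ.nWord W R a : Module.End R (Ψ.FreeMod R)) * Ψ.e R (W.simple a) *
    ((Ψ.nWord W R a)⁻¹ : LinearMap.GeneralLinearGroup R (Ψ.FreeMod R))

theorem rootVector_mul_self (a : ι) : Ψ.rootVector W R a * Ψ.rootVector W R a = 0 := by
  simp only [rootVector, mul_assoc, Units.inv_mul_cancel_left]
  rw [← mul_assoc (Ψ.e R _), e_mul_e, zero_mul, mul_zero]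

theorem n_mem (i : b.support) : Ψ.n R i ∈ Ψ.chevalleyGroup R :=
  mul_mem (mul_mem (Subgroup.subset_closure ⟨i, 1, Or.inl rfl⟩)
    (Subgroup.subset_closure ⟨i, -1, Or.inr rfl⟩)) (Subgroup.subset_closure ⟨i, 1, Or.inl rfl⟩)

theorem nWord_mem (a : ι) : Ψ.nWord W R a ∈ Ψ.chevalleyGroup R := by
  refine Subgroup.list_prod_mem _ fun g hg => ?_
  obtain ⟨i, -, rfl⟩ := List.mem_map.mp hg
  exact Ψ.n_mem R i

theorem unipotent_rootVector_eq (a : ι) (t : R) :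
    unipotent (Ψ.rootVector W R a) (Ψ.rootVector_mul_self W R a) t =
      Ψ.nWord W R a * Ψ.x R (W.simple a) t * (Ψ.nWord W R a)⁻¹ := by
  ext1
  simp only [unipotent, rootVector, x, Units.val_mul, mul_add, add_mul, mul_one,
    Units.mul_inv, Algebra.mul_smul_comm, Algebra.smul_mul_assoc]

/-- `x_α(t) = id + t 𝐞_α`, as an element of the Chevalley group `G_R(Ψ)`. -/
def xRoot (a : ι) (t : R) : Ψ.chevalleyGroup R :=
  ⟨unipotent (Ψ.rootVector W R a) (Ψ.rootVector_mul_self W R a) t, by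
    rw [unipotent_rootVector_eq]
    exact mul_mem (mul_mem (Ψ.nWord_mem W R a) (Subgroup.subset_closure ⟨_, t, Or.inl rfl⟩))
      (inv_mem (Ψ.nWord_mem W R a))⟩

end MinusculeSet

end MinusculeChevalley

end

/-!
Over `ℚ`, the `eᵢ` and `fᵢ` together with the diagonal operators that are linear in the weight
span a Lie algebra, and this Lie algebra is stable under conjugation by the `nᵢ`. Its weights
therefore form a Weyl-stable set; since each nonzero weight is a combination of simple roots with
coefficients of one sign, reflecting it down to a multiple of a simple root shows that it is a
root, and the weight space at a root `α` is the line of `𝐞_α`. So `[𝐞_α, 𝐞_β]` and `𝐞_α 𝐞_β 𝐞_α`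
are multiples of root vectors, and as `𝐞_α z_v = ± z_{v + α}`, the scalar can be read off on one
basis vector. When `α` and `β` are orthogonal with `α + β` a root, writing `α = (α - β) + β`
yields `±2`. A minuscule weight rules out type `G₂`, which bounds the root strings. All these
identities hold over `ℤ`, hence over every `R`, where the claims become identities between
square-zero elements of a ring.
-/

noncomputable section

namespace MinusculeChevalley

/-- The ring structure on `End R (α →₀ R)`. Instance synthesis does not recognise the subtraction
of these operators as that of a ring without this shortcut. -/
abbrev ringEndFinsupp (α R : Type*) [CommRing R] : Ring (Module.End R (α →₀ R)) :=
  Module.End.instRing (N₁ := α →₀ R)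

attribute [local instance] LieRing.ofAssociativeRing ringEndFinsupp Ring.instBracket

section WeightGrading

variable {K E : Type*} (s : Set E) (R : Type*) [CommRing R]

open Classical in
/-- The basis vector `z_v` of the free module on `s`, extended by `z_v = 0` for `v ∉ s`. -/
def basisVec (v : E) : s →₀ R :=
  if h : v ∈ s then Finsupp.single ⟨v, h⟩ 1 else 0

variable {s}

theorem basisVec_of_mem {v : E} (h : v ∈ s) : basisVec s R v = Finsupp.single ⟨v, h⟩ 1 :=
  dif_pos h

theorem basisVec_of_notMem {v : E} (h : v ∉ s) : basisVec s R v = 0 :=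
  dif_neg h

theorem basisVec_apply_self {v : E} (h : v ∈ s) : basisVec s R v ⟨v, h⟩ = 1 := by
  rw [basisVec_of_mem R h, Finsupp.single_eq_same]

theorem basisVec_apply_of_ne {v w : E} (hw : w ∈ s) (hne : v ≠ w) :
    basisVec s R v ⟨w, hw⟩ = 0 := by
  by_cases hv : v ∈ s
  · rw [basisVec_of_mem R hv, Finsupp.single_eq_of_ne (by simpa [Subtype.ext_iff] using hne.symm)]
  · rw [basisVec_of_notMem R hv, Finsupp.zero_apply]

variable {R}

theorem end_ext {x y : Module.End R (s →₀ R)}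
    (h : ∀ v ∈ s, x (basisVec s R v) = y (basisVec s R v)) : x = y := by
  refine Finsupp.lhom_ext' fun v => LinearMap.ext_ring ?_
  simpa [basisVec_of_mem R v.2] using h v v.2

variable [AddCommGroup E]

variable (s R) in
/-- The operators of weight `γ`: those sending every `z_v` to a multiple of `z_{v + γ}`. -/
def weightSpace (γ : E) : Submodule R (Module.End R (s →₀ R)) where
  carrier := {x | ∀ v, x (basisVec s R v) ∈ R ∙ basisVec s R (v + γ)}
  zero_mem' v := by simp
  add_mem' hx hy v := add_mem (hx v) (hy v)
  smul_mem' c x hx v := Submodule.smul_mem _ c (hx v)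

theorem mul_mem_weightSpace {x y : Module.End R (s →₀ R)} {γ δ : E}
    (hx : x ∈ weightSpace s R γ) (hy : y ∈ weightSpace s R δ) :
    x * y ∈ weightSpace s R (γ + δ) := by
  intro v
  obtain ⟨c, hc⟩ := Submodule.mem_span_singleton.mp (hy v)
  rw [Module.End.mul_apply, ← hc, map_smul, add_comm γ, ← add_assoc]
  exact Submodule.smul_mem _ c (hx _)

theorem lie_mem_weightSpace {x y : Module.End R (s →₀ R)} {γ δ : E}
    (hx : x ∈ weightSpace s R γ) (hy : y ∈ weightSpace s R δ) :
    ⁅x, y⁆ ∈ weightSpace s R (γ + δ) := by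
  rw [Ring.lie_def]
  exact sub_mem (mul_mem_weightSpace hx hy) (add_comm γ δ ▸ mul_mem_weightSpace hy hx)

variable (s R) in
/-- The operators `x` whose component of weight `γ` vanishes, i.e. for which the coefficient of
`x z_v` at `z_{v + γ}` is zero. -/
def offWeight (γ : E) : Submodule R (Module.End R (s →₀ R)) where
  carrier := {x | ∀ v (h : v + γ ∈ s), x (basisVec s R v) ⟨v + γ, h⟩ = 0}
  zero_mem' v _ := by simp
  add_mem' hx hy v h := by simp [hx v h, hy v h]
  smul_mem' c x hx v h := by simp [hx v h]

theorem weightSpace_le_offWeight {γ δ : E} (hne : δ ≠ γ) :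
    weightSpace s R δ ≤ offWeight s R γ := by
  intro x hx v h
  obtain ⟨c, hc⟩ := Submodule.mem_span_singleton.mp (hx v)
  rw [← hc, Finsupp.smul_apply, basisVec_apply_of_ne R h (by simpa using hne), smul_zero]

theorem disjoint_weightSpace_offWeight (γ : E) :
    Disjoint (weightSpace s R γ) (offWeight s R γ) := by
  refine Submodule.disjoint_def.mpr fun x hx hx' => end_ext fun v _ => ?_
  obtain ⟨c, hc⟩ := Submodule.mem_span_singleton.mp (hx v)
  rw [LinearMap.zero_apply, ← hc]
  by_cases h : v + γ ∈ s
  · have hc0 := hx' v h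
    rw [← hc, Finsupp.smul_apply, basisVec_apply_self, smul_eq_mul, mul_one] at hc0
    rw [hc0, zero_smul]
  · rw [basisVec_of_notMem R h, smul_zero]

theorem iSupIndep_weightSpace : iSupIndep (weightSpace s R) := fun γ =>
  (disjoint_weightSpace_offWeight γ).mono_right
    (iSup₂_le fun _ hne => weightSpace_le_offWeight hne)

variable [Semiring K] [Module K E]

/-- The operator `u` lifts the automorphism `w`: it sends every `z_v` to `± z_{w v}`. -/
def Lifts (u : LinearMap.GeneralLinearGroup R (s →₀ R)) (w : E ≃ₗ[K] E) : Prop :=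
  ∀ v, ∃ ε : ℤˣ, (u : Module.End R (s →₀ R)) (basisVec s R v) = ε • basisVec s R (w v)

namespace Lifts

variable {u u' : LinearMap.GeneralLinearGroup R (s →₀ R)} {w w' : E ≃ₗ[K] E}

theorem one : Lifts (1 : LinearMap.GeneralLinearGroup R (s →₀ R)) (1 : E ≃ₗ[K] E) :=
  fun _ => ⟨1, by simp⟩

theorem mul (h : Lifts u w) (h' : Lifts u' w') : Lifts (u * u') (w * w') := by
  intro v
  obtain ⟨ε', hε'⟩ := h' v
  obtain ⟨ε, hε⟩ := h (w' v)
  refine ⟨ε' * ε, ?_⟩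
  rw [Units.val_mul, Module.End.mul_apply, hε', Units.smul_def, map_zsmul, hε, mul_smul]
  rfl

theorem inv (h : Lifts u w) : Lifts u⁻¹ w⁻¹ := by
  intro v
  obtain ⟨ε, hε⟩ := h (w⁻¹ v)
  refine ⟨ε, ?_⟩
  rw [show w (w⁻¹ v) = v from w.apply_symm_apply v] at hε
  have hz : basisVec s R v = ε • (u : Module.End R (s →₀ R)) (basisVec s R (w⁻¹ v)) := by
    rw [hε, smul_smul, Int.units_mul_self, one_smul]
  rw [hz, Units.smul_def, map_zsmul, ← Module.End.mul_apply, Units.inv_mul, Module.End.one_apply]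
  rfl

theorem apply_mem [Nontrivial R] (h : Lifts u w) {v : E} (hv : v ∈ s) : w v ∈ s := by
  by_contra hw
  obtain ⟨ε, hε⟩ := h v
  rw [basisVec_of_notMem R hw, smul_zero] at hε
  have hz : basisVec s R v = 0 := by
    rw [← Module.End.one_apply (R := R) (basisVec s R v), ← Units.inv_mul u, Module.End.mul_apply,
      hε, map_zero]
  simp [basisVec_of_mem R hv] at hz

theorem list_prod {κ : Type*} {u : κ → LinearMap.GeneralLinearGroup R (s →₀ R)}
    {w : κ → E ≃ₗ[K] E} (h : ∀ k, Lifts (u k) (w k)) (l : List κ) :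
    Lifts (l.map u).prod (l.map w).prod := by
  induction l with
  | nil => exact one
  | cons k l ih => simpa only [List.map_cons, List.prod_cons] using (h k).mul ih

theorem conj_mem_weightSpace (h : Lifts u w) {x : Module.End R (s →₀ R)} {γ : E}
    (hx : x ∈ weightSpace s R γ) :
    (u * x * ↑u⁻¹ : Module.End R (s →₀ R)) ∈ weightSpace s R (w γ) := by
  intro v
  obtain ⟨ε, hε⟩ := h.inv v
  obtain ⟨c, hc⟩ := Submodule.mem_span_singleton.mp (hx (w⁻¹ v))
  obtain ⟨ε', hε'⟩ := h (w⁻¹ v + γ)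
  rw [map_add, show w (w⁻¹ v) = v from w.apply_symm_apply v] at hε'
  rw [Module.End.mul_apply, hε, Module.End.mul_apply, Units.smul_def, map_zsmul, ← hc, map_zsmul,
    map_smul, hε', Units.smul_def]
  exact zsmul_mem (Submodule.smul_mem _ _
    (zsmul_mem (Submodule.mem_span_singleton_self _) _)) _

end Lifts

end WeightGrading

section BaseChange

variable {α R S : Type*} [CommRing R] [CommRing S] (φ : R →+* S)

/-- The extension of scalars `R^(α) → S^(α)` along `φ`, as a semilinear map. -/
def extendScalars : (α →₀ R) →ₛₗ[φ] (α →₀ S) :=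
  Finsupp.mapRange.linearMap φ.toSemilinearMap

@[simp]
theorem extendScalars_single (a : α) (r : R) :
    extendScalars φ (Finsupp.single a r) = Finsupp.single a (φ r) :=
  Finsupp.mapRange_single (hf := map_zero φ)

theorem extendScalars_basisVec {E : Type*} {s : Set E} (v : E) :
    extendScalars φ (basisVec s R v) = basisVec s S v := by
  by_cases h : v ∈ s
  · rw [basisVec_of_mem R h, basisVec_of_mem S h, extendScalars_single, map_one]
  · rw [basisVec_of_notMem R h, basisVec_of_notMem S h, map_zero]

theorem eq_of_comp_extendScalars {x y : Module.End S (α →₀ S)}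
    (h : ∀ m, x (extendScalars φ m) = y (extendScalars φ m)) : x = y := by
  refine Finsupp.lhom_ext' fun a => LinearMap.ext_ring ?_
  simpa using h (Finsupp.single a 1)

/-- The operator induced by `x` on the extension of scalars. -/
def inducedEnd (x : Module.End R (α →₀ R)) : Module.End S (α →₀ S) :=
  Finsupp.linearCombination S fun a => extendScalars φ (x (Finsupp.single a 1))

@[simp]
theorem inducedEnd_extendScalars (x : Module.End R (α →₀ R)) (m : α →₀ R) :
    inducedEnd φ x (extendScalars φ m) = extendScalars φ (x m) := by
  induction m using Finsupp.induction_linear with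
  | zero => simp
  | add m m' hm hm' => simp only [map_add, hm, hm']
  | single a r =>
    rw [← mul_one r, ← smul_eq_mul, ← Finsupp.smul_single, map_smulₛₗ, map_smulₛₗ, map_smul,
      map_smulₛₗ]
    simp [inducedEnd]

/-- Base change of operators on free modules along a ring homomorphism. -/
def baseChange : Module.End R (α →₀ R) →+* Module.End S (α →₀ S) where
  toFun := inducedEnd φ
  map_one' := eq_of_comp_extendScalars φ fun _ => by simp
  map_mul' _ _ := eq_of_comp_extendScalars φ fun _ => by simp
  map_zero' := eq_of_comp_extendScalars φ fun _ => by simp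
  map_add' _ _ := eq_of_comp_extendScalars φ fun _ => by simp

theorem baseChange_eq_iff {x : Module.End R (α →₀ R)} {y : Module.End S (α →₀ S)} :
    baseChange φ x = y ↔
      ∀ a, y (Finsupp.single a 1) = extendScalars φ (x (Finsupp.single a 1)) := by
  refine ⟨?_, fun h => Finsupp.lhom_ext' fun a => LinearMap.ext_ring ?_⟩
  · rintro rfl a
    simp [baseChange, inducedEnd]
  · simp [baseChange, inducedEnd, h]

theorem baseChange_injective (hφ : Function.Injective φ) :
    Function.Injective (baseChange (α := α) φ) := by
  intro x y h
  have hφ' : Function.Injective (extendScalars (α := α) φ) :=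
    Finsupp.mapRange_injective φ (map_zero φ) hφ
  exact LinearMap.ext fun m => hφ' <| by
    simpa [baseChange] using LinearMap.congr_fun h (extendScalars φ m)

end BaseChange

section SquareZero

variable {A : Type*} [Ring A] {a b : A}

theorem conj_one_add_of_mul_mul_eq_zero (ha : a * a = 0) (hb : b * b = 0)
    (haba : a * b * a = 0) :
    (1 - b) * (1 + a) * (1 + b) = (1 + a) * (1 + ⁅a, b⁆) * (1 - b * a * b) := by
  rw [Ring.lie_def]
  linear_combination (norm := noncomm_ring)
    haba + haba * b + a * hb * (a * b) + ha * (b * b * a * b) - hb - ha * b - b * haba * b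
      - haba * (b * a * b)

theorem conj_one_add_of_mul_mul_eq_zero' (ha : a * a = 0) (hb : b * b = 0)
    (hbab : b * a * b = 0) :
    (1 - b) * (1 + a) * (1 + b) = (1 + a) * (1 + ⁅a, b⁆) * (1 + a * b * a) := by
  rw [Ring.lie_def]
  linear_combination (norm := noncomm_ring)
    b * ha * (b * a) + a * b * ha * (b * a) - hb - hbab - ha * b - ha * (b * a) - a * hbab * a
      - ha * (b * a * b * a)

theorem commute_lie_of_mul_mul_eq_zero (ha : a * a = 0) (haba : a * b * a = 0) :
    Commute a ⁅a, b⁆ := by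
  rw [Ring.lie_def, commute_iff_eq]
  linear_combination (norm := noncomm_ring) ha * b + b * ha - 2 • haba

theorem commute_mul_mul_of_mul_mul_eq_zero (haba : a * b * a = 0) : Commute a (b * a * b) := by
  rw [commute_iff_eq]
  linear_combination (norm := noncomm_ring) haba * b - b * haba

theorem commute_lie_mul_mul (hb : b * b = 0) (haba : a * b * a = 0) :
    Commute ⁅a, b⁆ (b * a * b) := by
  rw [Ring.lie_def, commute_iff_eq]
  linear_combination (norm := noncomm_ring)
    a * hb * (a * b) - 2 • (b * haba * b) + b * a * hb * a

theorem lie_lie_self_of_mul_self_eq_zero (ha : a * a = 0) :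
    ⁅a, ⁅a, b⁆⁆ = (-2 : ℤ) • (a * b * a) := by
  simp only [Ring.lie_def]
  linear_combination (norm := noncomm_ring) ha * b + b * ha

end SquareZero

section UnipotentConj

variable {K A : Type*} [Field K] [NeZero (2 : K)] [Ring A] [Algebra K A]

theorem one_add_mul_mul_one_sub_mem {T : Submodule K A} {g : A} (hg : g * g = 0)
    (hT : ∀ x ∈ T, ⁅g, x⁆ ∈ T) {x : A} (hx : x ∈ T) : (1 + g) * x * (1 - g) ∈ T := by
  have hgxg : g * x * g = (-2⁻¹ : K) • ⁅g, ⁅g, x⁆⁆ := by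
    rw [lie_lie_self_of_mul_self_eq_zero hg, ← Int.cast_smul_eq_zsmul K, smul_smul]
    simp [two_ne_zero]
  have hexp : (1 + g) * x * (1 - g) = x + ⁅g, x⁆ - g * x * g := by
    rw [Ring.lie_def]; noncomm_ring
  rw [hexp, hgxg]
  exact sub_mem (add_mem hx (hT x hx)) (T.smul_mem _ (hT _ (hT x hx)))

end UnipotentConj

section IndependentFamily

variable {κ α : Type*} [CompleteLattice α] [IsModularLattice α] {𝒜 ℬ : κ → α}

theorem iSup_inf_eq_of_iSupIndep (h𝒜 : iSupIndep 𝒜) (hle : ∀ k, ℬ k ≤ 𝒜 k) (k : κ) :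
    (⨆ j, ℬ j) ⊓ 𝒜 k = ℬ k := by
  have hdisj : Disjoint (⨆ j ≠ k, ℬ j) (𝒜 k) :=
    (h𝒜 k).symm.mono_left (iSup₂_mono fun j _ => hle j)
  rw [iSup_split_single _ k, sup_inf_assoc_of_le _ (hle k), hdisj.eq_bot, sup_bot_eq]

end IndependentFamily

section Triangular

variable {K L κ : Type*} [CommRing K] [LieRing L] [LieAlgebra K L]

/-- The right-normed bracket `⁅g j₁, ⁅g j₂, … ⁅g jₖ, g i⁆…⁆⁆` along the word `j₁ ⋯ jₖ`. -/
def monomial (g : κ → L) (i : κ) : List κ → L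
  | [] => g i
  | j :: l => ⁅g j, monomial g i l⁆

variable (K) in
/-- The span of the right-normed brackets of a family; it is the Lie subalgebra that the family
generates. -/
def monomialSpan (g : κ → L) : Submodule K L :=
  Submodule.span K (Set.range fun w : κ × List κ => monomial g w.1 w.2)

/-- The triangular decomposition `𝔫⁻ + H + 𝔫⁺` attached to two families `g 1` and `g (-1)` of
raising and lowering operators and to a Cartan part `H`. -/
def triangular (H : Submodule K L) (g : ℤˣ → κ → L) : Submodule K L :=
  H ⊔ ⨆ σ, monomialSpan K (g σ)

theorem monomial_mem_monomialSpan (g : κ → L) (i : κ) (l : List κ) :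
    monomial g i l ∈ monomialSpan K g :=
  Submodule.subset_span ⟨(i, l), rfl⟩

theorem lie_mem_monomialSpan (g : κ → L) (j : κ) {x : L} (hx : x ∈ monomialSpan K g) :
    ⁅g j, x⁆ ∈ monomialSpan K g := by
  induction hx using Submodule.span_induction with
  | mem x hx =>
    obtain ⟨⟨i, l⟩, rfl⟩ := hx
    exact monomial_mem_monomialSpan g i (j :: l)
  | zero => simp
  | add x y _ _ hx hy => rw [lie_add]; exact add_mem hx hy
  | smul c x _ hx => rw [lie_smul]; exact Submodule.smul_mem _ c hx

variable {H : Submodule K L} {g : ℤˣ → κ → L}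

theorem lie_monomial_mem_span {h : L} {g : κ → L} (hg : ∀ j, ⁅h, g j⁆ ∈ K ∙ g j) (i : κ)
    (l : List κ) : ⁅h, monomial g i l⁆ ∈ K ∙ monomial g i l := by
  induction l with
  | nil => exact hg i
  | cons j l ih =>
    obtain ⟨c, hc⟩ := Submodule.mem_span_singleton.mp (hg j)
    obtain ⟨d, hd⟩ := Submodule.mem_span_singleton.mp ih
    rw [monomial, leibniz_lie, ← hc, ← hd, smul_lie, lie_smul]
    exact add_mem (Submodule.smul_mem _ _ (Submodule.mem_span_singleton_self _))
      (Submodule.smul_mem _ _ (Submodule.mem_span_singleton_self _))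

theorem lie_mem_sup_monomialSpan (hH : ∀ h ∈ H, ∀ σ j, ⁅h, g σ j⁆ ∈ K ∙ g σ j) (σ : ℤˣ) (j : κ)
    {x : L} (hx : x ∈ H ⊔ monomialSpan K (g σ)) : ⁅g σ j, x⁆ ∈ monomialSpan K (g σ) := by
  obtain ⟨h, hh, y, hy, rfl⟩ := Submodule.mem_sup.mp hx
  rw [lie_add, ← lie_skew]
  refine add_mem (neg_mem ?_) (lie_mem_monomialSpan _ j hy)
  exact (Submodule.span_singleton_le_iff_mem _ _).mpr (monomial_mem_monomialSpan _ j [])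
    (hH h hh σ j)

theorem lie_monomial_mem (hH : ∀ h ∈ H, ∀ σ j, ⁅h, g σ j⁆ ∈ K ∙ g σ j)
    (hg : ∀ σ i j, ⁅g σ i, g (-σ) j⁆ ∈ H) (σ : ℤˣ) (j i : κ) (l : List κ) :
    ⁅g (-σ) j, monomial (g σ) i l⁆ ∈ H ⊔ monomialSpan K (g σ) := by
  induction l with
  | nil => exact Submodule.mem_sup_left (by simpa [monomial] using hg (-σ) j i)
  | cons k l ih =>
    rw [monomial, leibniz_lie]
    have hjk : ⁅g (-σ) j, g σ k⁆ ∈ H := by simpa using hg (-σ) j k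
    refine Submodule.mem_sup_right (add_mem ?_ (lie_mem_sup_monomialSpan hH σ k ih))
    exact (Submodule.span_singleton_le_iff_mem _ _).mpr (monomial_mem_monomialSpan _ i l)
      (lie_monomial_mem_span (hH _ hjk σ) i l)

theorem lie_mem_triangular (hH : ∀ h ∈ H, ∀ σ j, ⁅h, g σ j⁆ ∈ K ∙ g σ j)
    (hg : ∀ σ i j, ⁅g σ i, g (-σ) j⁆ ∈ H) (σ : ℤˣ) (j : κ) {x : L} (hx : x ∈ triangular H g) :
    ⁅g σ j, x⁆ ∈ triangular H g := by
  have hle (τ : ℤˣ) : monomialSpan K (g τ) ≤ triangular H g :=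
    le_sup_of_le_right (le_iSup (fun τ => monomialSpan K (g τ)) τ)
  suffices triangular H g ≤ (triangular H g).comap (LieAlgebra.ad K L (g σ j)) from
    this hx
  refine sup_le (fun h hh => hle σ ?_) (iSup_le fun τ => Submodule.span_le.mpr ?_)
  · exact lie_mem_sup_monomialSpan hH σ j (Submodule.mem_sup_left hh)
  · rintro _ ⟨⟨i, l⟩, rfl⟩
    obtain rfl | hne := eq_or_ne σ τ
    · exact hle σ (monomial_mem_monomialSpan _ i (j :: l))
    · rw [Int.units_ne_iff_eq_neg.mp hne]
      exact sup_le le_sup_left (hle τ) (lie_monomial_mem hH hg τ j i l)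

end Triangular

section Cartan

variable {E : Type*} [AddCommGroup E] {s : Set E} {R : Type*} [CommRing R] [Module R E]

variable (s R) in
/-- The Cartan part: the diagonal operators whose eigenvalue at `z_v` is linear in `v`. -/
def cartan : Submodule R (Module.End R (s →₀ R)) where
  carrier := {h | ∃ φ : Module.Dual R E, ∀ v, h (basisVec s R v) = φ v • basisVec s R v}
  zero_mem' := ⟨0, fun v => by simp⟩
  add_mem' := by
    rintro _ _ ⟨φ, hφ⟩ ⟨ψ, hψ⟩
    exact ⟨φ + ψ, fun v => by simp [hφ v, hψ v, add_smul]⟩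
  smul_mem' := by
    rintro c _ ⟨φ, hφ⟩
    exact ⟨c • φ, fun v => by simp [hφ v, mul_smul]⟩

theorem cartan_le_weightSpace_zero : cartan s R ≤ weightSpace s R 0 := by
  rintro h ⟨φ, hφ⟩ v
  rw [hφ, add_zero]
  exact Submodule.smul_mem _ _ (Submodule.mem_span_singleton_self _)

theorem lie_mem_span_of_mem_cartan {h x : Module.End R (s →₀ R)} (hh : h ∈ cartan s R) {γ : E}
    (hx : x ∈ weightSpace s R γ) : ⁅h, x⁆ ∈ R ∙ x := by
  obtain ⟨φ, hφ⟩ := hh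
  refine Submodule.mem_span_singleton.mpr ⟨φ γ, end_ext fun v _ => ?_⟩
  obtain ⟨c, hc⟩ := Submodule.mem_span_singleton.mp (hx v)
  rw [Ring.lie_def, LinearMap.sub_apply, Module.End.mul_apply,
    Module.End.mul_apply, hφ, map_smul, LinearMap.smul_apply, ← hc, map_smul, hφ, map_add]
  module

end Cartan

variable {ι E N : Type*} [AddCommGroup E] [Module ℚ E] [AddCommGroup N] [Module ℚ N]
  {P : RootPairing ι ℚ E N} {b : P.Base} {α β γ δ : ι}

section SimpleSum

/-- The sum of a multiset of simple roots: the nonnegative integral combination of simple roots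
whose coefficients are the multiplicities. -/
def simpleSum (m : Multiset b.support) : E := (m.map fun i : b.support => P.root i).sum

theorem simpleSum_cons (i : b.support) (m : Multiset b.support) :
    simpleSum (i ::ₘ m) = P.root i + simpleSum m := by
  simp [simpleSum]

theorem simpleSum_singleton (i : b.support) : simpleSum {i} = P.root i := by
  simp [simpleSum]

variable [P.IsRootSystem]

open Classical in
theorem repr_simpleSum (m : Multiset b.support) (i : b.support) :
    b.toWeightBasis.repr (simpleSum m) i = m.count i := by
  induction m using Multiset.induction_on with
  | empty => simp [simpleSum]
  | cons j m ih =>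
    rw [simpleSum_cons, map_add, Finsupp.add_apply, ih, b.toWeightBasis_repr_root,
      Finsupp.single_apply, Multiset.count_cons]
    by_cases h : j = i <;> simp [h, Ne.symm, add_comm]

open Classical in
theorem eq_and_eq_of_smul_simpleSum_eq {σ τ : ℤˣ} {m m' : Multiset b.support} (hm : m ≠ 0)
    (h : σ • simpleSum m = τ • simpleSum m') : σ = τ ∧ m = m' := by
  have hcount (i : b.support) : (σ : ℚ) * m.count i = τ * m'.count i := by
    have hi := congrArg (b.toWeightBasis.repr · i) h
    simpa [Units.smul_def, repr_simpleSum] using hi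
  obtain rfl | hne := eq_or_ne σ τ
  · exact ⟨rfl, Multiset.ext.mpr fun i => by simpa using hcount i⟩
  · refine absurd (Multiset.eq_zero_of_forall_notMem fun i => ?_) hm
    have hi : (m.count i : ℚ) = -m'.count i := by
      have hi := hcount i
      rw [Int.units_ne_iff_eq_neg.mp hne] at hi
      rcases Int.units_eq_one_or τ with rfl | rfl <;> push_cast at hi <;> linarith
    rw [← Multiset.count_eq_zero]
    exact Nat.le_zero.mp (by exact_mod_cast (by linarith : (m.count i : ℚ) ≤ 0))

theorem simpleSum_ne_zero {m : Multiset b.support} (hm : m ≠ 0) : simpleSum m ≠ 0 := fun h =>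
  hm (eq_and_eq_of_smul_simpleSum_eq (σ := 1) (τ := 1) (m' := 0) hm (by rw [h]; simp [simpleSum])).2

theorem exists_coroot'_simpleSum_pos [Finite ι] {m : Multiset b.support} (hm : m ≠ 0) :
    ∃ i : b.support, 0 < P.coroot' i (simpleSum m) := by
  have := Fintype.ofFinite ι
  by_contra! hneg
  have hform (i : b.support) : P.RootForm (simpleSum m) (P.root i) ≤ 0 := by
    have h := congrArg (P.toLinearMap (simpleSum m)) (P.rootForm_self_smul_coroot i)
    rw [map_smul, map_nsmul, P.toLinearMap_apply_apply_Polarization,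
      ← P.rootForm_symmetric.eq (simpleSum m),
      RingHom.id_apply,
      smul_eq_mul, nsmul_eq_mul, Nat.cast_two] at h
    have := mul_nonpos_of_nonneg_of_nonpos (P.zero_le_rootForm (P.root i)) (hneg i)
    change _ * P.coroot' i (simpleSum m) = _ at h
    linarith
  have hsum (m' : Multiset b.support) : P.RootForm (simpleSum m) (simpleSum m') ≤ 0 := by
    induction m' using Multiset.induction_on with
    | empty => simp [simpleSum]
    | cons i m' ih => rw [simpleSum_cons, map_add]; exact add_nonpos (hform i) ih
  exact (P.rootForm_pos_of_ne_zero (by simp) (simpleSum_ne_zero hm)).not_ge (hsum m)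

open Classical in
theorem lt_or_eq_replicate_of_smul_reflection_simpleSum_eq {σ τ : ℤˣ} {m m' : Multiset b.support}
    {i : b.support} (hi : 0 < P.coroot' i (simpleSum m))
    (h : σ • P.reflection i (simpleSum m) = τ • simpleSum m') :
    (σ = τ ∧ m' < m) ∨ m = Multiset.replicate m.card i := by
  have hcount (a : b.support) : (σ : ℚ) * (m.count a - if a = i then P.coroot' i (simpleSum m)
      else 0) = τ * m'.count a := by
    have ha := congrArg (b.toWeightBasis.repr · a) h
    rw [P.reflection_apply] at ha
    simpa [Units.smul_def, repr_simpleSum, Finsupp.single_apply, eq_comm] using ha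
  obtain rfl | hne := eq_or_ne σ τ
  · have hsub (a : b.support) :
        (m.count a : ℚ) - (if a = i then P.coroot' i (simpleSum m) else 0) = m'.count a :=
      mul_left_cancel₀ (by exact_mod_cast σ.ne_zero) (hcount a)
    refine .inl ⟨rfl, lt_of_le_of_ne (Multiset.le_iff_count.mpr fun a => ?_) ?_⟩
    · have ha := hsub a
      qify
      split_ifs at ha <;> linarith
    · rintro rfl
      have := hsub i
      rw [if_pos rfl] at this
      linarith
  · refine .inr (Multiset.eq_replicate.mpr ⟨rfl, fun a ha => ?_⟩)
    by_contra hai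
    have hcount_a := hcount a
    rw [if_neg hai, sub_zero, Int.units_ne_iff_eq_neg.mp hne] at hcount_a
    have hpos : (0 : ℚ) < m.count a := by exact_mod_cast Multiset.count_pos.mpr ha
    rcases Int.units_eq_one_or τ with rfl | rfl <;> push_cast at hcount_a <;> linarith

end SimpleSum

section RootStrings

theorem coroot'_root_eq_pairingIn [P.IsCrystallographic] (i j : ι) :
    P.coroot' i (P.root j) = P.pairingIn ℤ j i := by
  rw [P.root_coroot'_eq_pairing, ← P.algebraMap_pairingIn ℤ, eq_intCast]

variable [Finite ι] [P.IsNotG2]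

theorem coroot'_root_mem_of_root_add_mem (h : P.root α + P.root β ∈ Set.range P.root) :
    (P.coroot' α (P.root β), P.coroot' β (P.root α)) ∈
      ({(0, 0), (-1, -1), (-1, -2), (-2, -1)} : Set (ℚ × ℚ)) := by
  obtain ⟨hne, hne'⟩ := (RootPairing.IsReduced.linearIndependent_iff P).mp
    (P.linearIndependent_of_add_mem_range_root' h)
  have hmem := P.pairingIn_pairingIn_mem_set_of_isCrystal_of_isRed' β α
    (P.root.injective.ne hne.symm) (fun h => hne' (by rw [h, neg_neg]))
  have hα := RootPairing.IsNotG2.pairingIn_mem_zero_one_two (P := P) α β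
  have hβ := RootPairing.IsNotG2.pairingIn_mem_zero_one_two (P := P) β α
  have hle := P.pairingIn_le_zero_of_root_add_mem h
  simp only [coroot'_root_eq_pairingIn, Set.mem_insert_iff, Set.mem_singleton_iff,
    Prod.mk.injEq] at hmem hα hβ ⊢
  norm_cast
  lia

theorem coroot'_root_eq_neg_two_iff (h : P.root α + P.root β ∈ Set.range P.root) :
    P.coroot' α (P.root β) = -2 ↔ 2 • P.root α + P.root β ∈ Set.range P.root := by
  have hli := P.linearIndependent_of_add_mem_range_root' h
  have hle := P.chainBotCoeff_add_chainTopCoeff_le_two α β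
  have hsub := P.chainBotCoeff_sub_chainTopCoeff hli
  rw [add_comm, RootPairing.root_add_nsmul_mem_range_iff_le_chainTopCoeff hli,
    coroot'_root_eq_pairingIn]
  norm_cast
  lia

end RootStrings

namespace MinusculeSet

variable (Ψ : MinusculeSet b)

variable (Ψ : MinusculeSet b)

section Weights

variable {v : E}

theorem reflection_root_mem (hv : v ∈ Ψ.carrier) (a : ι) : P.reflection a v ∈ Ψ.carrier := by
  obtain ⟨S, -, -, hS⟩ := Ψ.isUnion
  simp only [hS, Set.mem_iUnion] at hv ⊢
  obtain ⟨w, hw, g, rfl⟩ := hv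
  exact ⟨w, hw, RootPairing.weylGroup.ofIdx P a * g, by
    simp only [mul_smul, RootPairing.weylGroup.ofIdx_smul]; rfl⟩

theorem coroot'_mem (hv : v ∈ Ψ.carrier) (a : ι) :
    P.coroot' a v ∈ ({0, 1, -1} : Set ℚ) := by
  obtain ⟨S, -, hmin, hS⟩ := Ψ.isUnion
  simp only [hS, Set.mem_iUnion] at hv
  obtain ⟨w, hw, ⟨g, hg⟩, rfl⟩ := hv
  suffices ∀ u : E, (∀ a, P.coroot' a u ∈ ({0, 1, -1} : Set ℚ)) →
      ∀ a, P.coroot' a (g • u) ∈ ({0, 1, -1} : Set ℚ) from this w (hmin w hw).coroot_mem a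
  induction hg using RootPairing.weylGroup.induction with
  | mem i =>
    intro u hu a
    rw [show RootPairing.Equiv.reflection P i • u = P.reflection i u from rfl,
      P.coroot'_reflection]
    exact hu _
  | one => exact fun u hu a => by simpa using hu a
  | mul x y _ _ hx hy => exact fun u hu => by simpa only [mul_smul] using hx _ (hy _ hu)

theorem coroot'_cases (hv : v ∈ Ψ.carrier) (a : ι) :
    P.coroot' a v = 0 ∨ P.coroot' a v = 1 ∨ P.coroot' a v = -1 :=
  Ψ.coroot'_mem hv a

theorem coroot'_root_self (a : ι) : P.coroot' a (P.root a) = 2 := P.root_coroot_two a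

theorem add_smul_root_mem_iff (hv : v ∈ Ψ.carrier) (σ : ℤˣ) (a : ι) :
    v + σ • P.root a ∈ Ψ.carrier ↔ P.coroot' a v = -σ := by
  constructor
  · intro h
    have h₂ := Ψ.coroot'_cases h a
    rw [map_add, Units.smul_def, map_zsmul, coroot'_root_self, zsmul_eq_mul] at h₂
    have hσ : ((σ : ℤ) : ℚ) = 1 ∨ ((σ : ℤ) : ℚ) = -1 := by
      rcases Int.units_eq_one_or σ with rfl | rfl <;> simp
    rcases hσ with hσ | hσ <;> rcases Ψ.coroot'_cases hv a with h₁ | h₁ | h₁ <;>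
      rcases h₂ with h₂ | h₂ | h₂ <;> linarith
  · intro h
    have hr := Ψ.reflection_root_mem hv a
    rwa [P.reflection_apply, h, neg_smul, sub_neg_eq_add, Int.cast_smul_eq_zsmul,
      ← Units.smul_def] at hr

theorem add_root_mem_iff (hv : v ∈ Ψ.carrier) (a : ι) :
    v + P.root a ∈ Ψ.carrier ↔ P.coroot' a v = -1 := by
  simpa using Ψ.add_smul_root_mem_iff hv 1 a

theorem sub_root_mem_iff (hv : v ∈ Ψ.carrier) (a : ι) :
    v - P.root a ∈ Ψ.carrier ↔ P.coroot' a v = 1 := by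
  simpa [sub_eq_add_neg] using Ψ.add_smul_root_mem_iff hv (-1) a

end Weights

section Generators

variable (R : Type*) [CommRing R]

theorem e_basisVec {v : E} (hv : v ∈ Ψ.carrier) (i : b.support) :
    Ψ.e R i (basisVec Ψ.carrier R v) = basisVec Ψ.carrier R (v + P.root i) := by
  rw [basisVec_of_mem R hv, e, Finsupp.linearCombination_single, one_smul]
  split_ifs with h
  · rw [basisVec_of_mem]
  · rw [basisVec_of_notMem R (mt (Ψ.add_root_mem_iff hv i).mp h)]

theorem f_basisVec {v : E} (hv : v ∈ Ψ.carrier) (i : b.support) :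
    Ψ.f R i (basisVec Ψ.carrier R v) = basisVec Ψ.carrier R (v - P.root i) := by
  rw [basisVec_of_mem R hv, f, Finsupp.linearCombination_single, one_smul]
  split_ifs with h
  · rw [basisVec_of_mem]
  · rw [basisVec_of_notMem R (mt (Ψ.sub_root_mem_iff hv i).mp h)]

/-- The raising operators `eᵢ` (for the sign `1`) and the lowering operators `fᵢ` (for `-1`). -/
def generator (σ : ℤˣ) (i : b.support) : Module.End R (Ψ.FreeMod R) :=
  if σ = 1 then Ψ.e R i else Ψ.f R i

theorem generator_one (i : b.support) : Ψ.generator R 1 i = Ψ.e R i := if_pos rfl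

theorem generator_neg_one (i : b.support) : Ψ.generator R (-1) i = Ψ.f R i :=
  if_neg (by decide)

theorem generator_mul_self (σ : ℤˣ) (i : b.support) :
    Ψ.generator R σ i * Ψ.generator R σ i = 0 := by
  rcases Int.units_eq_one_or σ with rfl | rfl
  · rw [generator_one, e_mul_e]
  · rw [generator_neg_one, f_mul_f]

theorem generator_basisVec {v : E} (hv : v ∈ Ψ.carrier) (σ : ℤˣ) (i : b.support) :
    Ψ.generator R σ i (basisVec Ψ.carrier R v) =
      basisVec Ψ.carrier R (v + σ • P.root i) := by
  rcases Int.units_eq_one_or σ with rfl | rfl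
  · rw [generator_one, e_basisVec Ψ R hv, one_smul]
  · rw [generator_neg_one, f_basisVec Ψ R hv, Units.neg_smul, one_smul, sub_eq_add_neg]

theorem generator_mem_weightSpace (σ : ℤˣ) (i : b.support) :
    Ψ.generator R σ i ∈ weightSpace Ψ.carrier R (σ • P.root i) := by
  intro v
  by_cases hv : v ∈ Ψ.carrier
  · rw [generator_basisVec Ψ R hv]
    exact Submodule.mem_span_singleton_self _
  · rw [basisVec_of_notMem R hv, map_zero]
    exact zero_mem _

theorem n_val (i : b.support) :
    (Ψ.n R i : Module.End R (Ψ.FreeMod R)) = (1 + Ψ.e R i) * (1 - Ψ.f R i) * (1 + Ψ.e R i) := by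
  simp [n, x, y, unipotent, sub_eq_add_neg]

theorem lifts_n (i : b.support) : Lifts (Ψ.n R i) (P.reflection (i : ι)) := by
  intro v
  by_cases hv : v ∈ Ψ.carrier
  · have he {u : E} (hu : u ∈ Ψ.carrier) : (1 + Ψ.e R i) (basisVec Ψ.carrier R u) =
        basisVec Ψ.carrier R u + basisVec Ψ.carrier R (u + P.root i) := by
      rw [LinearMap.add_apply, Module.End.one_apply, e_basisVec Ψ R hu]
    have hf {u : E} (hu : u ∈ Ψ.carrier) : (1 - Ψ.f R i) (basisVec Ψ.carrier R u) =
        basisVec Ψ.carrier R u - basisVec Ψ.carrier R (u - P.root i) := by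
      rw [LinearMap.sub_apply, Module.End.one_apply, f_basisVec Ψ R hu]
    have hadd := Ψ.add_root_mem_iff hv i
    have hsub := Ψ.sub_root_mem_iff hv i
    rw [n_val, Module.End.mul_apply, Module.End.mul_apply, he hv, P.reflection_apply]
    rcases Ψ.coroot'_cases hv i with h | h | h <;> norm_num [h] at hadd hsub
    · refine ⟨1, ?_⟩
      rw [basisVec_of_notMem R hadd, add_zero, hf hv, basisVec_of_notMem R hsub, sub_zero, he hv,
        basisVec_of_notMem R hadd, h]
      simp
    · refine ⟨-1, ?_⟩
      rw [basisVec_of_notMem R hadd, add_zero, hf hv, map_sub, he hv, he hsub,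
        basisVec_of_notMem R hadd, h]
      simp
    · refine ⟨1, ?_⟩
      have hadd₂ : v + P.root i + P.root i ∉ Ψ.carrier := by
        rw [Ψ.add_root_mem_iff hadd, map_add, coroot'_root_self, h]
        norm_num
      rw [map_add, hf hv, hf hadd, basisVec_of_notMem R hsub, add_sub_cancel_right,
        sub_zero, add_sub_cancel, he hadd, basisVec_of_notMem R hadd₂, h]
      simp
  · have hsv : P.reflection (i : ι) v ∉ Ψ.carrier := fun h => hv <| by
      simpa using Ψ.reflection_mem h i
    exact ⟨1, by rw [basisVec_of_notMem R hv, basisVec_of_notMem R hsv, map_zero, smul_zero]⟩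

variable (W : RootWords b)

theorem lifts_nWord (a : ι) : Lifts (Ψ.nWord W R a)
    ((W.word a).map fun j : b.support => P.reflection (j : ι)).prod :=
  Lifts.list_prod (Ψ.lifts_n R) _

theorem rootVector_basisVec [Nontrivial R] {v : E} (hv : v ∈ Ψ.carrier) (a : ι) :
    ∃ ε : ℤˣ, Ψ.rootVector W R a (basisVec Ψ.carrier R v) =
      ε • basisVec Ψ.carrier R (v + P.root a) := by
  set w := ((W.word a).map fun j : b.support => P.reflection (j : ι)).prod
  have hw : Lifts (Ψ.nWord W R a) w := Ψ.lifts_nWord R W a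
  obtain ⟨ε, hε⟩ := hw.inv v
  obtain ⟨ε', hε'⟩ := hw (w⁻¹ v + P.root (W.simple a))
  rw [map_add, show w (w⁻¹ v) = v from w.apply_symm_apply v, ← W.root_eq a] at hε'
  refine ⟨ε * ε', ?_⟩
  rw [rootVector, Module.End.mul_apply, hε, Module.End.mul_apply, Units.smul_def, map_zsmul,
    e_basisVec Ψ R (hw.inv.apply_mem hv), map_zsmul, hε', mul_smul, Units.smul_def ε]

theorem rootVector_mem_weightSpace (a : ι) :
    Ψ.rootVector W R a ∈ weightSpace Ψ.carrier R (P.root a) := by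
  rw [W.root_eq a]
  refine (Ψ.lifts_nWord R W a).conj_mem_weightSpace ?_
  simpa [generator_one] using Ψ.generator_mem_weightSpace R 1 (W.simple a)

end Generators

section Relations

variable (R : Type*) [CommRing R]

open Classical in
theorem generator_mul_generator_basisVec {v : E} (hv : v ∈ Ψ.carrier) (σ τ : ℤˣ)
    (i j : b.support) :
    (Ψ.generator R σ i * Ψ.generator R τ j) (basisVec Ψ.carrier R v) =
      if v + τ • P.root j ∈ Ψ.carrier then
        basisVec Ψ.carrier R (v + τ • P.root j + σ • P.root i) else 0 := by
  rw [Module.End.mul_apply, generator_basisVec Ψ R hv]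
  split_ifs with h
  · rw [generator_basisVec Ψ R h]
  · rw [basisVec_of_notMem R h, map_zero]

theorem lie_generator_neg_basisVec {v : E} (hv : v ∈ Ψ.carrier) (σ : ℤˣ) (i : b.support) :
    ⁅Ψ.generator ℚ σ i, Ψ.generator ℚ (-σ) i⁆ (basisVec Ψ.carrier ℚ v) =
      (σ * P.coroot' i v) • basisVec Ψ.carrier ℚ v := by
  classical
  rw [Ring.lie_def, LinearMap.sub_apply,
    generator_mul_generator_basisVec Ψ ℚ hv, generator_mul_generator_basisVec Ψ ℚ hv,
    Units.neg_smul, add_assoc, add_assoc, neg_add_cancel, add_neg_cancel, add_zero,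
    ← Units.neg_smul, Ψ.add_smul_root_mem_iff hv, Ψ.add_smul_root_mem_iff hv]
  rcases Int.units_eq_one_or σ with rfl | rfl <;>
    rcases Ψ.coroot'_cases hv i with h | h | h <;> norm_num [h]

theorem add_neg_smul_root_mem {v : E} (hv : v ∈ Ψ.carrier) {σ : ℤˣ} {i j : ι}
    (hij : P.coroot' j (P.root i) ≤ 0) (h : v + σ • P.root i + -σ • P.root j ∈ Ψ.carrier) :
    v + -σ • P.root j ∈ Ψ.carrier := by
  rw [Ψ.add_smul_root_mem_iff hv]
  have hv' := Ψ.coroot'_cases hv j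
  have hu' := Ψ.coroot'_cases h j
  rw [map_add, map_add, Units.smul_def, Units.smul_def, map_zsmul, map_zsmul,
    coroot'_root_self, P.root_coroot'_eq_pairing] at hu'
  rw [P.root_coroot'_eq_pairing] at hij
  rcases Int.units_eq_one_or σ with rfl | rfl <;>
    rcases hv' with h₁ | h₁ | h₁ <;> rcases hu' with h₂ | h₂ | h₂ <;>
    norm_num [h₁] at h₂ ⊢ <;> linarith

variable [Finite ι] [P.IsCrystallographic]

theorem coroot'_simple_nonpos {i j : b.support} (hij : i ≠ j) : P.coroot' i (P.root j) ≤ 0 := by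
  have h := b.pairingIn_le_zero_of_ne (i := (j : ι)) (j := (i : ι))
    (fun h => hij (Subtype.ext h.symm)) j.2 i.2
  rw [P.root_coroot'_eq_pairing, ← P.algebraMap_pairingIn ℤ, eq_intCast]
  exact_mod_cast h

theorem lie_generator_neg_of_ne (σ : ℤˣ) {i j : b.support} (hij : i ≠ j) :
    ⁅Ψ.generator R σ i, Ψ.generator R (-σ) j⁆ = 0 := by
  classical
  refine end_ext fun v hv => ?_
  rw [Ring.lie_def, LinearMap.sub_apply,
    generator_mul_generator_basisVec Ψ R hv, generator_mul_generator_basisVec Ψ R hv,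
    add_right_comm v (-σ • P.root (j : ι)), LinearMap.zero_apply]
  by_cases hu : v + σ • P.root (i : ι) + -σ • P.root (j : ι) ∈ Ψ.carrier
  · have hj := Ψ.add_neg_smul_root_mem hv (coroot'_simple_nonpos hij.symm) hu
    have hi : v + - -σ • P.root (i : ι) ∈ Ψ.carrier :=
      Ψ.add_neg_smul_root_mem hv (coroot'_simple_nonpos hij) (by rwa [neg_neg, add_right_comm])
    rw [neg_neg] at hi
    rw [if_pos hj, if_pos hi, sub_self]
  · simp only [basisVec_of_notMem R hu, ite_self, sub_zero]

theorem lie_generator_neg_mem_cartan (σ : ℤˣ) (i j : b.support) :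
    ⁅Ψ.generator ℚ σ i, Ψ.generator ℚ (-σ) j⁆ ∈ cartan Ψ.carrier ℚ := by
  obtain rfl | hij := eq_or_ne i j
  · refine ⟨(σ : ℚ) • P.coroot' i, fun v => ?_⟩
    by_cases hv : v ∈ Ψ.carrier
    · exact Ψ.lie_generator_neg_basisVec hv σ i
    · rw [basisVec_of_notMem ℚ hv, map_zero, smul_zero]
  · rw [lie_generator_neg_of_ne Ψ ℚ σ hij]
    exact zero_mem _

end Relations

section LieAlgebra

/-- The Lie algebra generated by the operators `eᵢ` and `fᵢ` over `ℚ`, enlarged by the whole Cartan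
part. -/
def lieSpan : Submodule ℚ (Module.End ℚ (Ψ.FreeMod ℚ)) :=
  triangular (cartan Ψ.carrier ℚ) (Ψ.generator ℚ)

theorem monomialSpan_le_lieSpan (σ : ℤˣ) : monomialSpan ℚ (Ψ.generator ℚ σ) ≤ Ψ.lieSpan :=
  le_sup_of_le_right (le_iSup (fun τ => monomialSpan ℚ (Ψ.generator ℚ τ)) σ)

variable [Finite ι] [P.IsCrystallographic]

theorem lie_generator_mem_lieSpan (σ : ℤˣ) (i : b.support) {x : Module.End ℚ (Ψ.FreeMod ℚ)}
    (hx : x ∈ Ψ.lieSpan) : ⁅Ψ.generator ℚ σ i, x⁆ ∈ Ψ.lieSpan :=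
  lie_mem_triangular (H := cartan Ψ.carrier ℚ) (g := Ψ.generator ℚ)
    (fun _ hh τ j => lie_mem_span_of_mem_cartan hh (Ψ.generator_mem_weightSpace ℚ τ j))
    Ψ.lie_generator_neg_mem_cartan σ i hx

theorem conj_one_add_smul_mem_lieSpan (σ : ℤˣ) (i : b.support) (t : ℚ)
    {x : Module.End ℚ (Ψ.FreeMod ℚ)} (hx : x ∈ Ψ.lieSpan) :
    (1 + t • Ψ.generator ℚ σ i) * x * (1 - t • Ψ.generator ℚ σ i) ∈ Ψ.lieSpan := by
  refine one_add_mul_mul_one_sub_mem ?_ (fun y hy => ?_) hx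
  · rw [smul_mul_smul_comm, generator_mul_self, smul_zero]
  · rw [smul_lie]
    exact Submodule.smul_mem _ _ (Ψ.lie_generator_mem_lieSpan σ i hy)

theorem conj_mem_lieSpan {u : LinearMap.GeneralLinearGroup ℚ (Ψ.FreeMod ℚ)}
    (hu : u ∈ Ψ.chevalleyGroup ℚ) :
    ∀ x ∈ Ψ.lieSpan, (u * x * ↑u⁻¹ : Module.End ℚ (Ψ.FreeMod ℚ)) ∈ Ψ.lieSpan := by
  induction hu using Subgroup.closure_induction'' with
  | mem u hu =>
    obtain ⟨i, t, rfl | rfl⟩ := hu <;> intro x hx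
    · have h := Ψ.conj_one_add_smul_mem_lieSpan 1 i t hx
      rwa [generator_one] at h
    · have h := Ψ.conj_one_add_smul_mem_lieSpan (-1) i t hx
      rwa [generator_neg_one] at h
  | inv_mem u hu =>
    obtain ⟨i, t, rfl | rfl⟩ := hu <;> intro x hx
    · have h := Ψ.conj_one_add_smul_mem_lieSpan 1 i (-t) hx
      rwa [generator_one, neg_smul, sub_neg_eq_add, ← sub_eq_add_neg] at h
    · have h := Ψ.conj_one_add_smul_mem_lieSpan (-1) i (-t) hx
      rwa [generator_neg_one, neg_smul, sub_neg_eq_add, ← sub_eq_add_neg] at h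
  | one => exact fun x hx => by simpa using hx
  | mul u u' _ _ hu hu' =>
    intro x hx
    simpa only [mul_inv_rev, Units.val_mul, mul_assoc] using hu _ (hu' x hx)

variable (W : RootWords b) (a : ι)

theorem rootVector_mem_lieSpan : Ψ.rootVector W ℚ a ∈ Ψ.lieSpan := by
  refine Ψ.conj_mem_lieSpan (Ψ.nWord_mem W ℚ a) _ ?_
  rw [← generator_one]
  exact Ψ.monomialSpan_le_lieSpan 1 (monomial_mem_monomialSpan _ _ [])

theorem lie_rootVector_mem_lieSpan {x : Module.End ℚ (Ψ.FreeMod ℚ)} (hx : x ∈ Ψ.lieSpan) :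
    ⁅Ψ.rootVector W ℚ a, x⁆ ∈ Ψ.lieSpan := by
  set u := Ψ.nWord W ℚ a
  have hu : u ∈ Ψ.chevalleyGroup ℚ := Ψ.nWord_mem W ℚ a
  have hy : (↑u⁻¹ * x * u : Module.End ℚ (Ψ.FreeMod ℚ)) ∈ Ψ.lieSpan := by
    simpa using Ψ.conj_mem_lieSpan (inv_mem hu) x hx
  have hconj : ⁅Ψ.rootVector W ℚ a, x⁆ =
      u * ⁅Ψ.generator ℚ 1 (W.simple a), ↑u⁻¹ * x * u⁆ * ↑u⁻¹ := by
    simp only [Ring.lie_def, generator_one, rootVector, mul_sub, sub_mul,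
      mul_assoc, Units.mul_inv_cancel_left, Units.mul_inv, mul_one, u]
  rw [hconj]
  exact Ψ.conj_mem_lieSpan hu _ (Ψ.lie_generator_mem_lieSpan 1 _ hy)

end LieAlgebra

section LieAlgebraWeights

theorem monomial_mem_weightSpace (σ : ℤˣ) (i : b.support) (l : List b.support) :
    monomial (Ψ.generator ℚ σ) i l ∈
      weightSpace Ψ.carrier ℚ (σ • simpleSum (i ::ₘ (l : Multiset b.support))) := by
  induction l with
  | nil => simpa [monomial, simpleSum] using Ψ.generator_mem_weightSpace ℚ σ i
  | cons j l ih =>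
    rw [← Multiset.cons_coe, Multiset.cons_swap, simpleSum_cons, smul_add]
    exact lie_mem_weightSpace (Ψ.generator_mem_weightSpace ℚ σ j) ih

/-- `Ψ.IsLieGenerator γ x` says that `x` is one of the weight vectors spanning `Ψ.lieSpan`, either
from the Cartan part or a right-normed bracket of the operators `eᵢ` or of the operators `fᵢ`,
and that `γ` is its weight. -/
inductive IsLieGenerator : E → Module.End ℚ (Ψ.FreeMod ℚ) → Prop
  | cartan {h} (hh : h ∈ cartan Ψ.carrier ℚ) : IsLieGenerator 0 h
  | monomial (σ : ℤˣ) (i : b.support) (l : List b.support) :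
    IsLieGenerator (σ • simpleSum (i ::ₘ (l : Multiset b.support)))
      (monomial (Ψ.generator ℚ σ) i l)

theorem lieSpan_le_iSup_span :
    Ψ.lieSpan ≤ ⨆ γ, Submodule.span ℚ {x | Ψ.IsLieGenerator γ x} := by
  have hmem {γ : E} {x} (hx : Ψ.IsLieGenerator γ x) :
      x ∈ ⨆ γ, Submodule.span ℚ {x | Ψ.IsLieGenerator γ x} :=
    Submodule.mem_iSup_of_mem γ (Submodule.subset_span hx)
  refine sup_le (fun h hh => hmem (.cartan hh)) (iSup_le fun σ => Submodule.span_le.mpr ?_)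
  rintro _ ⟨⟨i, l⟩, rfl⟩
  exact hmem (.monomial σ i l)

theorem mem_span_of_mem_weightSpace {x : Module.End ℚ (Ψ.FreeMod ℚ)} (hx : x ∈ Ψ.lieSpan)
    {γ : E} (hγ : x ∈ weightSpace Ψ.carrier ℚ γ) :
    x ∈ Submodule.span ℚ {y | Ψ.IsLieGenerator γ y} := by
  rw [← iSup_inf_eq_of_iSupIndep (ℬ := fun γ => Submodule.span ℚ {y | Ψ.IsLieGenerator γ y})
    iSupIndep_weightSpace ?_ γ]
  · exact ⟨Ψ.lieSpan_le_iSup_span hx, hγ⟩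
  · refine fun δ => Submodule.span_le.mpr ?_
    rintro _ (hh | ⟨σ, i, l⟩)
    · exact cartan_le_weightSpace_zero hh
    · exact Ψ.monomial_mem_weightSpace σ i l

theorem exists_isLieGenerator {x : Module.End ℚ (Ψ.FreeMod ℚ)} (hx : x ∈ Ψ.lieSpan)
    {γ : E} (hγ : x ∈ weightSpace Ψ.carrier ℚ γ) (hx₀ : x ≠ 0) : ∃ y, Ψ.IsLieGenerator γ y := by
  by_contra! hempty
  have h := Ψ.mem_span_of_mem_weightSpace hx hγ
  simp only [hempty, Set.ofPred_false, Submodule.span_empty, Submodule.mem_bot] at h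
  exact hx₀ h

theorem monomial_replicate_eq_zero (σ : ℤˣ) (i : b.support) (k : ℕ) :
    monomial (Ψ.generator ℚ σ) i (List.replicate (k + 1) i) = 0 := by
  induction k with
  | zero => exact lie_self (Ψ.generator ℚ σ i)
  | succ k ih => rw [List.replicate_succ, monomial, ih, lie_zero]

variable [P.IsRootSystem]

theorem mem_span_monomial_replicate {x : Module.End ℚ (Ψ.FreeMod ℚ)} (hx : x ∈ Ψ.lieSpan)
    {σ : ℤˣ} {i : b.support} {k : ℕ}
    (hw : x ∈ weightSpace Ψ.carrier ℚ (σ • simpleSum (Multiset.replicate (k + 1) i))) :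
    x ∈ ℚ ∙ monomial (Ψ.generator ℚ σ) i (List.replicate k i) := by
  have hne : Multiset.replicate (k + 1) i ≠ 0 := by simp
  refine Submodule.span_mono ?_ (Ψ.mem_span_of_mem_weightSpace hx hw)
  intro y hy
  generalize hγ : σ • simpleSum (Multiset.replicate (k + 1) i) = γ at hy
  rcases hy with _ | ⟨τ, j, l⟩
  · exact absurd ((smul_eq_zero_iff_eq σ).mp hγ) (simpleSum_ne_zero hne)
  · obtain ⟨rfl, hl⟩ := eq_and_eq_of_smul_simpleSum_eq hne hγ
    rw [← Multiset.coe_replicate, Multiset.cons_coe, Multiset.coe_eq_coe] at hl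
    obtain ⟨rfl, rfl⟩ : j = i ∧ l = List.replicate k i := by
      simpa [List.replicate_succ] using List.perm_replicate.mp hl.symm
    rfl

theorem mem_span_generator {x : Module.End ℚ (Ψ.FreeMod ℚ)} (hx : x ∈ Ψ.lieSpan) {σ : ℤˣ}
    {i : b.support} (hw : x ∈ weightSpace Ψ.carrier ℚ (σ • P.root i)) :
    x ∈ ℚ ∙ Ψ.generator ℚ σ i :=
  Ψ.mem_span_monomial_replicate (k := 0) hx (by simpa [simpleSum_singleton] using hw)

variable [Finite ι] [P.IsCrystallographic]

theorem smul_simpleSum_mem_range_root {x : Module.End ℚ (Ψ.FreeMod ℚ)} (hx : x ∈ Ψ.lieSpan)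
    (hx₀ : x ≠ 0) {σ : ℤˣ} {m : Multiset b.support} (hm : m ≠ 0)
    (hw : x ∈ weightSpace Ψ.carrier ℚ (σ • simpleSum m)) :
    σ • simpleSum m ∈ Set.range P.root := by
  classical
  induction m using Multiset.strongInductionOn generalizing x σ with
  | _ m ih =>
  obtain ⟨i, hi⟩ := exists_coroot'_simpleSum_pos hm
  set y : Module.End ℚ (Ψ.FreeMod ℚ) := Ψ.n ℚ i * x * ↑(Ψ.n ℚ i)⁻¹ with hy
  have hyL : y ∈ Ψ.lieSpan := Ψ.conj_mem_lieSpan (Ψ.n_mem ℚ i) x hx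
  have hyw : y ∈ weightSpace Ψ.carrier ℚ (σ • P.reflection i (simpleSum m)) := by
    simpa [Units.smul_def] using (Ψ.lifts_n ℚ i).conj_mem_weightSpace hw
  have hy₀ : y ≠ 0 := by
    simpa [hy] using hx₀
  obtain ⟨z, hz⟩ := Ψ.exists_isLieGenerator hyL hyw hy₀
  generalize hγ : σ • P.reflection i (simpleSum m) = γ at hz
  rcases hz with _ | ⟨τ, j, l⟩
  · rw [smul_eq_zero_iff_eq, EmbeddingLike.map_eq_zero_iff] at hγ
    exact absurd hγ (simpleSum_ne_zero hm)
  obtain ⟨rfl, hlt⟩ | hrep := lt_or_eq_replicate_of_smul_reflection_simpleSum_eq hi hγ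
  · rw [hγ] at hyw
    obtain ⟨a, ha⟩ := ih _ hlt hyL hy₀ Multiset.cons_ne_zero hyw
    refine ⟨P.reflectionPerm i a, ?_⟩
    rw [P.root_reflectionPerm, ha, ← hγ, Units.smul_def, map_zsmul, P.reflection_same,
      Units.smul_def]
  · obtain ⟨k, hk⟩ := Nat.exists_eq_succ_of_ne_zero (Multiset.card_eq_zero.not.mpr hm)
    rw [hrep, hk] at hw ⊢
    cases k with
    | zero =>
      rw [Multiset.replicate_one, simpleSum_singleton]
      rcases Int.units_eq_one_or σ with rfl | rfl
      · exact ⟨i, (one_smul _ _).symm⟩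
      · exact ⟨P.reflectionPerm i i, by simp [Units.smul_def]⟩
    | succ k =>
      have h := Ψ.mem_span_monomial_replicate hx hw
      rw [monomial_replicate_eq_zero, Submodule.span_zero_singleton, Submodule.mem_bot] at h
      exact absurd h hx₀

theorem mem_range_root_of_mem_weightSpace {x : Module.End ℚ (Ψ.FreeMod ℚ)} (hx : x ∈ Ψ.lieSpan)
    (hx₀ : x ≠ 0) {γ : E} (hγ : γ ≠ 0) (hw : x ∈ weightSpace Ψ.carrier ℚ γ) :
    γ ∈ Set.range P.root := by
  obtain ⟨_, h | ⟨σ, i, l⟩⟩ := Ψ.exists_isLieGenerator hx hw hx₀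
  · exact absurd rfl hγ
  · exact Ψ.smul_simpleSum_mem_range_root hx hx₀ Multiset.cons_ne_zero hw

end LieAlgebraWeights

variable (W : RootWords b)

section BaseChange

variable {R S : Type*} [CommRing R] [CommRing S] (φ : R →+* S)

theorem baseChange_e (i : b.support) : baseChange φ (Ψ.e R i) = Ψ.e S i := by
  refine (baseChange_eq_iff φ).mpr fun v => ?_
  rw [← basisVec_of_mem S v.2, ← basisVec_of_mem R v.2, e_basisVec Ψ S v.2, e_basisVec Ψ R v.2,
    extendScalars_basisVec]

theorem baseChange_f (i : b.support) : baseChange φ (Ψ.f R i) = Ψ.f S i := by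
  refine (baseChange_eq_iff φ).mpr fun v => ?_
  rw [← basisVec_of_mem S v.2, ← basisVec_of_mem R v.2, f_basisVec Ψ S v.2, f_basisVec Ψ R v.2,
    extendScalars_basisVec]

theorem unitsMap_baseChange_n (i : b.support) :
    Units.map (baseChange φ).toMonoidHom (Ψ.n R i) = Ψ.n S i := by
  ext1
  change baseChange φ (Ψ.n R i).val = _
  rw [n_val, n_val, map_mul, map_mul, map_sub, map_add, map_one, baseChange_e, baseChange_f]

theorem unitsMap_baseChange_nWord (a : ι) :
    Units.map (baseChange φ).toMonoidHom (Ψ.nWord W R a) = Ψ.nWord W S a := by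
  rw [nWord, map_list_prod, List.map_map]
  exact congrArg List.prod (List.map_congr_left fun i _ => Ψ.unitsMap_baseChange_n φ i)

theorem baseChange_rootVector (a : ι) :
    baseChange φ (Ψ.rootVector W R a) = Ψ.rootVector W S a := by
  rw [rootVector, rootVector, ← Ψ.unitsMap_baseChange_nWord W φ, ← map_inv, map_mul, map_mul,
    baseChange_e]
  rfl

end BaseChange

section Integrality

variable {Ψ W} {c : ℤ} (R : Type*) [CommRing R]

theorem lie_rootVector_eq_of_rat
    (h : ⁅Ψ.rootVector W ℚ α, Ψ.rootVector W ℚ β⁆ = c • Ψ.rootVector W ℚ γ) :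
    ⁅Ψ.rootVector W R α, Ψ.rootVector W R β⁆ = c • Ψ.rootVector W R γ := by
  have hℤ : ⁅Ψ.rootVector W ℤ α, Ψ.rootVector W ℤ β⁆ = c • Ψ.rootVector W ℤ γ := by
    apply baseChange_injective (Int.castRingHom ℚ) Int.cast_injective
    simpa only [Ring.lie_def, map_sub, map_mul, map_zsmul, baseChange_rootVector] using h
  simpa only [Ring.lie_def, map_sub, map_mul, map_zsmul, baseChange_rootVector] using
    congrArg (baseChange (Int.castRingHom R)) hℤ

theorem mul_rootVector_mul_eq_of_rat
    (h : Ψ.rootVector W ℚ α * Ψ.rootVector W ℚ β * Ψ.rootVector W ℚ α =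
      c • Ψ.rootVector W ℚ γ) :
    Ψ.rootVector W R α * Ψ.rootVector W R β * Ψ.rootVector W R α = c • Ψ.rootVector W R γ := by
  have hℤ : Ψ.rootVector W ℤ α * Ψ.rootVector W ℤ β * Ψ.rootVector W ℤ α =
      c • Ψ.rootVector W ℤ γ := by
    apply baseChange_injective (Int.castRingHom ℚ) Int.cast_injective
    simpa only [map_mul, map_zsmul, baseChange_rootVector] using h
  simpa only [map_mul, map_zsmul, baseChange_rootVector] using
    congrArg (baseChange (Int.castRingHom R)) hℤ

end Integrality

section RootSpaces

variable [Finite ι] [P.IsRootSystem] [P.IsCrystallographic]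

theorem mem_span_rootVector {x : Module.End ℚ (Ψ.FreeMod ℚ)} (hx : x ∈ Ψ.lieSpan) {a : ι}
    (hw : x ∈ weightSpace Ψ.carrier ℚ (P.root a)) : x ∈ ℚ ∙ Ψ.rootVector W ℚ a := by
  set u := Ψ.nWord W ℚ a
  have hy : (↑u⁻¹ * x * u : Module.End ℚ (Ψ.FreeMod ℚ)) ∈
      ℚ ∙ Ψ.generator ℚ 1 (W.simple a) := by
    refine Ψ.mem_span_generator ?_ ?_
    · simpa using Ψ.conj_mem_lieSpan (inv_mem (Ψ.nWord_mem W ℚ a)) x hx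
    · have h := (Ψ.lifts_nWord ℚ W a).inv.conj_mem_weightSpace hw
      rw [inv_inv, W.root_eq a] at h
      rw [one_smul]
      convert h
      exact (LinearEquiv.symm_apply_apply _ _).symm
  obtain ⟨c, hc⟩ := Submodule.mem_span_singleton.mp hy
  refine Submodule.mem_span_singleton.mpr ⟨c, ?_⟩
  rw [rootVector, ← generator_one, ← smul_mul_assoc, ← mul_smul_comm, hc]
  simp [u, mul_assoc]

theorem lie_rootVector_eq_zero (R : Type*) [CommRing R] (h₀ : P.root β ≠ -P.root α)
    (h : P.root α + P.root β ∉ Set.range P.root) :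
    ⁅Ψ.rootVector W R α, Ψ.rootVector W R β⁆ = 0 := by
  suffices hℚ : ⁅Ψ.rootVector W ℚ α, Ψ.rootVector W ℚ β⁆ = 0 by
    simpa using lie_rootVector_eq_of_rat (γ := α) (c := 0) R (by rwa [zero_smul])
  by_contra hne
  refine h (Ψ.mem_range_root_of_mem_weightSpace
    (Ψ.lie_rootVector_mem_lieSpan W α (Ψ.rootVector_mem_lieSpan W β)) hne ?_
    (lie_mem_weightSpace (Ψ.rootVector_mem_weightSpace ℚ W α)
      (Ψ.rootVector_mem_weightSpace ℚ W β)))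
  rwa [Ne, add_comm, add_eq_zero_iff_eq_neg]

end RootSpaces

theorem exists_ne_zero_mem : ∃ v ∈ Ψ.carrier, v ≠ 0 := by
  obtain ⟨S, ⟨v, hv⟩, hmin, hS⟩ := Ψ.isUnion
  exact ⟨v, hS ▸ Set.mem_biUnion hv (MulAction.mem_orbit_self v), (hmin v hv).ne_zero⟩

section Irreducible

variable [P.IsIrreducible]

theorem span_carrier_eq_top : Submodule.span ℚ Ψ.carrier = ⊤ := by
  obtain ⟨v, hv, hv₀⟩ := Ψ.exists_ne_zero_mem
  refine RootPairing.IsIrreducible.eq_top_of_invtSubmodule_reflection (P := P) _ (fun a => ?_) ?_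
  · rw [Module.End.mem_invtSubmodule, Submodule.span_le]
    exact fun w hw => Submodule.subset_span (Ψ.reflection_root_mem hw a)
  · exact Submodule.ne_bot_iff _ |>.mpr ⟨v, Submodule.subset_span hv, hv₀⟩

theorem exists_add_root_mem (a : ι) : ∃ v ∈ Ψ.carrier, v + P.root a ∈ Ψ.carrier := by
  obtain ⟨v, hv, hva⟩ : ∃ v ∈ Ψ.carrier, P.coroot' a v ≠ 0 := by
    by_contra! h₀
    have hker : ⊤ ≤ LinearMap.ker (P.coroot' a) :=
      Ψ.span_carrier_eq_top ▸ Submodule.span_le.mpr h₀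
    have hself := LinearMap.mem_ker.mp (hker (Submodule.mem_top (x := P.root a)))
    norm_num [coroot'_root_self] at hself
  rcases Ψ.coroot'_cases hv a with h | h | h
  · exact absurd h hva
  · exact ⟨v - P.root a, (Ψ.sub_root_mem_iff hv a).mpr h, by rwa [sub_add_cancel]⟩
  · exact ⟨v, hv, (Ψ.add_root_mem_iff hv a).mpr h⟩

theorem rootVector_ne_zero (R : Type*) [CommRing R] [Nontrivial R] (a : ι) :
    Ψ.rootVector W R a ≠ 0 := by
  intro h
  obtain ⟨v, hv, hva⟩ := Ψ.exists_add_root_mem a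
  obtain ⟨ε, hε⟩ := Ψ.rootVector_basisVec R W hv a
  rw [h, LinearMap.zero_apply, eq_comm, smul_eq_zero_iff_eq] at hε
  simpa [hε] using basisVec_apply_self R hva

theorem eq_smul_rootVector_iff {K : Type*} [Field K] {x : Module.End K (Ψ.FreeMod K)} {a : ι}
    {c : ℤ} (h : x = c • Ψ.rootVector W K a) (z : K) :
    x = z • Ψ.rootVector W K a ↔ z = c := by
  rw [h, ← Int.cast_smul_eq_zsmul K, smul_left_inj (Ψ.rootVector_ne_zero W K a), eq_comm]

variable [Finite ι] [P.IsCrystallographic]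

include Ψ in
theorem isNotG2 [P.IsReduced] : P.IsNotG2 := by
  rw [← RootPairing.not_isG2_iff_isNotG2, RootPairing.isG2_iff]
  rintro ⟨i, j, hij⟩
  obtain ⟨v, hv, hvi⟩ := Ψ.exists_add_root_mem i
  have h := Ψ.coroot'_cases hvi j
  rw [map_add, coroot'_root_eq_pairingIn, hij] at h
  rcases Ψ.coroot'_cases hv j with hj | hj | hj <;> norm_num [hj] at h

end Irreducible

section Products

variable (R : Type*) [CommRing R]

theorem mul_rootVector_mul_eq_zero (h : P.coroot' α (P.root β) ≠ -2) :
    Ψ.rootVector W R α * Ψ.rootVector W R β * Ψ.rootVector W R α = 0 := by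
  have hα := Ψ.rootVector_mem_weightSpace R W α
  refine end_ext fun v hv => ?_
  rw [LinearMap.zero_apply, mul_assoc, Module.End.mul_apply]
  obtain ⟨c, hc⟩ := Submodule.mem_span_singleton.mp
    (mul_mem_weightSpace (Ψ.rootVector_mem_weightSpace R W β) hα v)
  by_cases hvβ : v + (P.root β + P.root α) ∈ Ψ.carrier
  · obtain ⟨d, hd⟩ := Submodule.mem_span_singleton.mp (hα v)
    obtain ⟨d', hd'⟩ := Submodule.mem_span_singleton.mp (hα (v + (P.root β + P.root α)))
    by_cases hvα : v + P.root α ∈ Ψ.carrier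
    · rw [← hc, map_smul, ← hd', basisVec_of_notMem, smul_zero, smul_zero]
      rw [Ψ.add_root_mem_iff hvβ, map_add, map_add, (Ψ.add_root_mem_iff hv α).mp hvα,
        coroot'_root_self]
      exact fun h' => h (by linarith)
    · rw [Module.End.mul_apply, ← hd, basisVec_of_notMem R hvα, smul_zero, map_zero, map_zero]
  · rw [← hc, basisVec_of_notMem R hvβ, smul_zero, map_zero]

variable [Nontrivial R]

theorem rootVector_mul_rootVector_basisVec {v : E} (hv : v ∈ Ψ.carrier)
    (hvβ : v + P.root β ∈ Ψ.carrier) :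
    ∃ ε : ℤˣ, (Ψ.rootVector W R α * Ψ.rootVector W R β) (basisVec Ψ.carrier R v) =
      ε • basisVec Ψ.carrier R (v + P.root β + P.root α) := by
  obtain ⟨ε, hε⟩ := Ψ.rootVector_basisVec R W hv β
  obtain ⟨ε', hε'⟩ := Ψ.rootVector_basisVec R W hvβ α
  exact ⟨ε * ε', by rw [Module.End.mul_apply, hε, Units.smul_def, map_zsmul, hε', mul_smul,
    Units.smul_def ε]⟩

theorem rootVector_mul_rootVector_basisVec_eq_zero {v : E} (hv : v ∈ Ψ.carrier)
    (hvβ : v + P.root β ∉ Ψ.carrier) :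
    (Ψ.rootVector W R α * Ψ.rootVector W R β) (basisVec Ψ.carrier R v) = 0 := by
  obtain ⟨ε, hε⟩ := Ψ.rootVector_basisVec R W hv β
  rw [Module.End.mul_apply, hε, basisVec_of_notMem R hvβ, smul_zero, map_zero]

end Products

section Vanishing

variable [Finite ι] [P.IsCrystallographic] [P.IsReduced] [P.IsIrreducible]

theorem mul_rootVector_mul_eq_zero_of_notMem (R : Type*) [CommRing R]
    (hγ : P.root γ = P.root α + P.root β)
    (h : 2 • P.root α + P.root β ∉ Set.range P.root) :
    Ψ.rootVector W R α * Ψ.rootVector W R β * Ψ.rootVector W R α = 0 :=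
  have := Ψ.isNotG2
  Ψ.mul_rootVector_mul_eq_zero W R (mt (coroot'_root_eq_neg_two_iff ⟨γ, hγ⟩).mp h)

include Ψ in
theorem add_two_nsmul_root_notMem (hγ : P.root γ = P.root α + P.root β)
    (hδ : P.root δ = 2 • P.root α + P.root β) :
    P.root α + 2 • P.root β ∉ Set.range P.root := by
  have := Ψ.isNotG2
  have hγ' := hγ.trans (add_comm _ _)
  have hα := (coroot'_root_eq_neg_two_iff ⟨γ, hγ⟩).mpr ⟨δ, hδ⟩
  have hmem := coroot'_root_mem_of_root_add_mem (P := P) ⟨γ, hγ⟩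
  rw [add_comm, ← coroot'_root_eq_neg_two_iff ⟨γ, hγ'⟩]
  intro hβ
  norm_num [hα, hβ] at hmem

end Vanishing

section StructureConstants

variable [Finite ι] [P.IsCrystallographic]

theorem mul_rootVector_mul_mem_lieSpan :
    Ψ.rootVector W ℚ α * Ψ.rootVector W ℚ β * Ψ.rootVector W ℚ α ∈ Ψ.lieSpan := by
  have hlie := Ψ.lie_rootVector_mem_lieSpan W α
    (Ψ.lie_rootVector_mem_lieSpan W α (Ψ.rootVector_mem_lieSpan W β))
  rw [lie_lie_self_of_mul_self_eq_zero (Ψ.rootVector_mul_self W ℚ α),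
    ← Int.cast_smul_eq_zsmul ℚ] at hlie
  exact (Submodule.smul_mem_iff _ (by norm_num)).mp hlie

variable [P.IsRootSystem]

theorem exists_eq_units_smul_rootVector {x : Module.End ℚ (Ψ.FreeMod ℚ)} (hx : x ∈ Ψ.lieSpan)
    {a : ι} (hw : x ∈ weightSpace Ψ.carrier ℚ (P.root a)) {v : E} (hv : v ∈ Ψ.carrier)
    (hva : v + P.root a ∈ Ψ.carrier) {ε : ℤˣ}
    (h : x (basisVec Ψ.carrier ℚ v) = ε • basisVec Ψ.carrier ℚ (v + P.root a)) :
    ∃ c : ℤˣ, x = c • Ψ.rootVector W ℚ a := by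
  obtain ⟨c, rfl⟩ := Submodule.mem_span_singleton.mp (Ψ.mem_span_rootVector W hx hw)
  obtain ⟨ε', hε'⟩ := Ψ.rootVector_basisVec ℚ W hv a
  refine ⟨ε * ε', ?_⟩
  have hcoeff : c * ε' = ε := by
    simpa [hε', Units.smul_def, basisVec_apply_self] using congrArg (· ⟨v + P.root a, hva⟩) h
  rw [Units.smul_def, ← Int.cast_smul_eq_zsmul ℚ, Units.val_mul, Int.cast_mul, ← hcoeff, mul_assoc,
    ← Int.cast_mul, Int.units_coe_mul_self, Int.cast_one, mul_one]

variable [P.IsIrreducible]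

theorem exists_lie_eq_units_smul (hγ : P.root γ = P.root α + P.root β)
    (h : P.coroot' α (P.root β) = -1) :
    ∃ ε : ℤˣ, ⁅Ψ.rootVector W ℚ α, Ψ.rootVector W ℚ β⁆ = ε • Ψ.rootVector W ℚ γ := by
  have hw : ⁅Ψ.rootVector W ℚ α, Ψ.rootVector W ℚ β⁆ ∈ weightSpace Ψ.carrier ℚ (P.root γ) :=
    hγ ▸ lie_mem_weightSpace (Ψ.rootVector_mem_weightSpace ℚ W α)
      (Ψ.rootVector_mem_weightSpace ℚ W β)
  have hlie := Ψ.lie_rootVector_mem_lieSpan W α (Ψ.rootVector_mem_lieSpan W β)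
  obtain ⟨v, hv, hvγ⟩ := Ψ.exists_add_root_mem γ
  have hvβα : v + P.root γ = v + P.root β + P.root α := by rw [hγ]; abel
  have hvαβ : v + P.root γ = v + P.root α + P.root β := by rw [hγ]; abel
  have hval : P.coroot' α (v + P.root γ) = P.coroot' α v + 1 := by
    rw [hγ, map_add, map_add, h, coroot'_root_self]; ring
  have hβ : v + P.root β ∈ Ψ.carrier ↔ P.coroot' α v = 0 := by
    rw [← add_sub_cancel_right (v + P.root β) (P.root α), ← hvβα, Ψ.sub_root_mem_iff hvγ, hval,
      add_eq_right]
  have hα := Ψ.add_root_mem_iff hv α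
  obtain ⟨ε, hε⟩ : ∃ ε : ℤˣ, ⁅Ψ.rootVector W ℚ α, Ψ.rootVector W ℚ β⁆
      (basisVec Ψ.carrier ℚ v) = ε • basisVec Ψ.carrier ℚ (v + P.root γ) := by
    rw [Ring.lie_def, LinearMap.sub_apply]
    rcases Ψ.coroot'_cases hv α with ha | ha | ha
    · obtain ⟨ε, hε⟩ := Ψ.rootVector_mul_rootVector_basisVec W ℚ (α := α) hv (hβ.mpr ha)
      refine ⟨ε, ?_⟩
      rw [hε, hvβα, Ψ.rootVector_mul_rootVector_basisVec_eq_zero W ℚ hv, sub_zero]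
      norm_num [hα, ha]
    · rcases Ψ.coroot'_cases hvγ α with hb | hb | hb <;> linarith
    · obtain ⟨ε, hε⟩ := Ψ.rootVector_mul_rootVector_basisVec W ℚ (α := β) hv (hα.mpr ha)
      refine ⟨-ε, ?_⟩
      rw [hε, hvαβ, Ψ.rootVector_mul_rootVector_basisVec_eq_zero W ℚ hv, zero_sub,
        Units.neg_smul]
      norm_num [hβ, ha]
  exact Ψ.exists_eq_units_smul_rootVector W hlie hw hv hvγ hε

theorem exists_lie_eq_units_smul' (hγ : P.root γ = P.root α + P.root β)
    (h : P.coroot' β (P.root α) = -1) :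
    ∃ ε : ℤˣ, ⁅Ψ.rootVector W ℚ α, Ψ.rootVector W ℚ β⁆ = ε • Ψ.rootVector W ℚ γ := by
  obtain ⟨ε, hε⟩ := Ψ.exists_lie_eq_units_smul W (hγ.trans (add_comm _ _)) h
  exact ⟨-ε, by rw [← lie_skew, hε, Units.neg_smul]⟩

theorem exists_mul_rootVector_mul_eq_units_smul (hδ : P.root δ = 2 • P.root α + P.root β)
    (h : P.coroot' α (P.root β) = -2) :
    ∃ ε : ℤˣ, Ψ.rootVector W ℚ α * Ψ.rootVector W ℚ β * Ψ.rootVector W ℚ α =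
      ε • Ψ.rootVector W ℚ δ := by
  have hα := Ψ.rootVector_mem_weightSpace ℚ W α
  have hw : Ψ.rootVector W ℚ α * Ψ.rootVector W ℚ β * Ψ.rootVector W ℚ α ∈
      weightSpace Ψ.carrier ℚ (P.root δ) := by
    rw [show P.root δ = P.root α + P.root β + P.root α by rw [hδ]; abel]
    exact mul_mem_weightSpace (mul_mem_weightSpace hα (Ψ.rootVector_mem_weightSpace ℚ W β)) hα
  obtain ⟨v, hv, hvδ⟩ := Ψ.exists_add_root_mem δ
  have hval : P.coroot' α (v + P.root δ) = P.coroot' α v + 2 := by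
    rw [hδ, map_add, map_add, map_nsmul, h, coroot'_root_self]; ring
  have ha : P.coroot' α v = -1 := by
    rcases Ψ.coroot'_cases hv α with ha | ha | ha <;>
      rcases Ψ.coroot'_cases hvδ α with hb | hb | hb <;> linarith
  have hvα : v + P.root α ∈ Ψ.carrier := (Ψ.add_root_mem_iff hv α).mpr ha
  have hvαβ : v + P.root α + P.root β ∈ Ψ.carrier := by
    rw [show v + P.root α + P.root β = v + P.root δ - P.root α by rw [hδ]; abel,
      Ψ.sub_root_mem_iff hvδ, hval, ha]
    norm_num
  have hvαβα : v + P.root α + P.root β + P.root α = v + P.root δ := by rw [hδ]; abel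
  obtain ⟨ε, hε⟩ := Ψ.rootVector_mul_rootVector_basisVec W ℚ (α := β) hv hvα
  obtain ⟨ε', hε'⟩ := Ψ.rootVector_basisVec ℚ W hvαβ α
  refine Ψ.exists_eq_units_smul_rootVector W (ε := ε * ε') (Ψ.mul_rootVector_mul_mem_lieSpan W)
    hw hv hvδ ?_
  rw [mul_assoc, Module.End.mul_apply, hε, Units.smul_def, map_zsmul, hε', hvαβα, mul_smul,
    Units.smul_def ε]

variable [P.IsReduced]

theorem exists_lie_eq_two_mul_units_smul (hγ : P.root γ = P.root α + P.root β)
    (h : P.coroot' β (P.root α) = 0) :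
    ∃ ε : ℤˣ, ⁅Ψ.rootVector W ℚ α, Ψ.rootVector W ℚ β⁆ = (2 * ε : ℤ) • Ψ.rootVector W ℚ γ := by
  have := Ψ.isNotG2
  obtain ⟨δ, hδ⟩ : ∃ δ, P.root δ = P.root α - P.root β :=
    ⟨P.reflectionPerm β γ, by
      rw [P.root_reflectionPerm, P.reflection_apply, hγ, map_add, h, coroot'_root_self]; module⟩
  have hβδ : P.coroot' β (P.root δ) = -2 := by rw [hδ, map_sub, h, coroot'_root_self]; ring
  have hδβ : P.coroot' δ (P.root β) = -1 := by
    have := coroot'_root_mem_of_root_add_mem (P := P) (α := δ) (β := β) ⟨α, by rw [hδ]; abel⟩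
    norm_num [hβδ] at this
    exact this
  obtain ⟨ε, hε⟩ := Ψ.exists_lie_eq_units_smul W (γ := α) (by rw [hδ]; abel) hδβ
  obtain ⟨ε', hε'⟩ := Ψ.exists_mul_rootVector_mul_eq_units_smul W (δ := γ)
    (by rw [hδ, hγ]; module) hβδ
  have hα : Ψ.rootVector W ℚ α = (ε : ℤ) • ⁅Ψ.rootVector W ℚ δ, Ψ.rootVector W ℚ β⁆ := by
    rw [hε, Units.smul_def, smul_smul, Int.units_coe_mul_self, one_smul]
  refine ⟨-(ε * ε'), ?_⟩
  rw [hα, smul_lie, ← lie_skew, ← lie_skew (Ψ.rootVector W ℚ δ), lie_neg, neg_neg,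
    lie_lie_self_of_mul_self_eq_zero (Ψ.rootVector_mul_self W ℚ β), hε', Units.smul_def,
    smul_smul, smul_smul]
  congr 1
  push_cast
  ring

theorem exists_lie_eq_smul (hγ : P.root γ = P.root α + P.root β) :
    ∃ c ∈ ({1, -1, 2, -2} : Set ℤ),
      ⁅Ψ.rootVector W ℚ α, Ψ.rootVector W ℚ β⁆ = c • Ψ.rootVector W ℚ γ := by
  have := Ψ.isNotG2
  have hmem := coroot'_root_mem_of_root_add_mem (P := P) (α := α) (β := β) ⟨γ, hγ⟩
  simp only [Set.mem_insert_iff, Set.mem_singleton_iff, Prod.mk.injEq] at hmem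
  rcases hmem with ⟨-, h⟩ | ⟨-, h⟩ | ⟨h, -⟩ | ⟨-, h⟩
  · obtain ⟨ε, hε⟩ := Ψ.exists_lie_eq_two_mul_units_smul W hγ h
    exact ⟨_, by rcases Int.units_eq_one_or ε with rfl | rfl <;> simp, hε⟩
  · obtain ⟨ε, hε⟩ := Ψ.exists_lie_eq_units_smul' W hγ h
    exact ⟨ε, by rcases Int.units_eq_one_or ε with rfl | rfl <;> simp, hε⟩
  · obtain ⟨ε, hε⟩ := Ψ.exists_lie_eq_units_smul W hγ h
    exact ⟨ε, by rcases Int.units_eq_one_or ε with rfl | rfl <;> simp, hε⟩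
  · obtain ⟨ε, hε⟩ := Ψ.exists_lie_eq_units_smul' W hγ h
    exact ⟨ε, by rcases Int.units_eq_one_or ε with rfl | rfl <;> simp, hε⟩

theorem exists_mul_rootVector_mul_eq_smul (hγ : P.root γ = P.root α + P.root β)
    (hδ : P.root δ = 2 • P.root α + P.root β) :
    ∃ c ∈ ({1, -1} : Set ℤ), Ψ.rootVector W ℚ α * Ψ.rootVector W ℚ β * Ψ.rootVector W ℚ α =
      c • Ψ.rootVector W ℚ δ := by
  have := Ψ.isNotG2
  obtain ⟨ε, hε⟩ := Ψ.exists_mul_rootVector_mul_eq_units_smul W hδ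
    ((coroot'_root_eq_neg_two_iff ⟨γ, hγ⟩).mpr ⟨δ, hδ⟩)
  exact ⟨ε, by rcases Int.units_eq_one_or ε with rfl | rfl <;> simp, hε⟩

end StructureConstants

section RootElements

variable {R : Type*} [CommRing R]

theorem coe_xRoot (a : ι) (t : R) :
    ((Ψ.xRoot W R a t : LinearMap.GeneralLinearGroup R (Ψ.FreeMod R)) :
      Module.End R (Ψ.FreeMod R)) = 1 + t • Ψ.rootVector W R a := rfl

theorem commute_xRoot_iff {a a' : ι} {t t' : R} :
    Commute (Ψ.xRoot W R a t) (Ψ.xRoot W R a' t') ↔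
      Commute (t • Ψ.rootVector W R a) (t' • Ψ.rootVector W R a') := by
  simp only [commute_iff_eq, Subtype.ext_iff, Units.ext_iff, Subgroup.coe_mul, Units.val_mul,
    coe_xRoot, add_mul, mul_add, one_mul, mul_one]
  grind

theorem commute_xRoot (h : ⁅Ψ.rootVector W R α, Ψ.rootVector W R β⁆ = 0) (t u : R) :
    Commute (Ψ.xRoot W R α t) (Ψ.xRoot W R β u) := by
  have hcomm : Commute (Ψ.rootVector W R α) (Ψ.rootVector W R β) := by
    rwa [Ring.lie_def, sub_eq_zero] at h
  exact (commute_xRoot_iff Ψ W).mpr ((hcomm.smul_left t).smul_right u)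

theorem smul_rootVector_mul_self (a : ι) (t : R) :
    (t • Ψ.rootVector W R a) * (t • Ψ.rootVector W R a) = 0 := by
  rw [smul_mul_smul_comm, rootVector_mul_self, smul_zero]

theorem smul_rootVector_mul_mul {c : ℤ}
    (h : Ψ.rootVector W R α * Ψ.rootVector W R β * Ψ.rootVector W R α = c • Ψ.rootVector W R δ)
    (t u : R) :
    (t • Ψ.rootVector W R α) * (u • Ψ.rootVector W R β) * (t • Ψ.rootVector W R α) =
      (c * t ^ 2 * u) • Ψ.rootVector W R δ := by
  rw [smul_mul_smul_comm, smul_mul_smul_comm, h, ← Int.cast_smul_eq_zsmul R, smul_smul]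
  ring_nf

theorem smul_rootVector_mul_mul_eq_zero
    (h : Ψ.rootVector W R α * Ψ.rootVector W R β * Ψ.rootVector W R α = 0) (t u : R) :
    (t • Ψ.rootVector W R α) * (u • Ψ.rootVector W R β) * (t • Ψ.rootVector W R α) = 0 := by
  rw [smul_mul_smul_comm, smul_mul_smul_comm, h, smul_zero]

variable {c : ℤ} (h : ⁅Ψ.rootVector W R α, Ψ.rootVector W R β⁆ = c • Ψ.rootVector W R γ)

include h

theorem lie_smul_rootVector (t u : R) :
    ⁅t • Ψ.rootVector W R α, u • Ψ.rootVector W R β⁆ = (c * t * u) • Ψ.rootVector W R γ := by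
  rw [smul_lie, lie_smul, h, ← Int.cast_smul_eq_zsmul R, smul_smul, smul_smul]
  ring_nf

theorem conj_xRoot
    (hαβα : Ψ.rootVector W R α * Ψ.rootVector W R β * Ψ.rootVector W R α = 0)
    (hβαβ : Ψ.rootVector W R β * Ψ.rootVector W R α * Ψ.rootVector W R β = 0) (t u : R) :
    Ψ.xRoot W R β (-u) * Ψ.xRoot W R α t * Ψ.xRoot W R β u =
      Ψ.xRoot W R α t * Ψ.xRoot W R γ (c * t * u) := by
  have hconj := conj_one_add_of_mul_mul_eq_zero (Ψ.smul_rootVector_mul_self W α t)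
    (Ψ.smul_rootVector_mul_self W β u) (Ψ.smul_rootVector_mul_mul_eq_zero W hαβα t u)
  rw [Ψ.lie_smul_rootVector W h, Ψ.smul_rootVector_mul_mul_eq_zero W hβαβ, sub_zero,
    mul_one] at hconj
  refine Subtype.ext (Units.ext ?_)
  simpa only [Subgroup.coe_mul, Units.val_mul, coe_xRoot, neg_smul, ← sub_eq_add_neg] using hconj

theorem conj_xRoot_of_mul_mul_right {c' : ℤ}
    (hαβα : Ψ.rootVector W R α * Ψ.rootVector W R β * Ψ.rootVector W R α = 0)
    (hβαβ : Ψ.rootVector W R β * Ψ.rootVector W R α * Ψ.rootVector W R β =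
      c' • Ψ.rootVector W R δ) (t u : R) :
    Ψ.xRoot W R β (-u) * Ψ.xRoot W R α t * Ψ.xRoot W R β u =
      Ψ.xRoot W R α t * Ψ.xRoot W R γ (c * t * u) * Ψ.xRoot W R δ (-c' * t * u ^ 2) := by
  have hconj := conj_one_add_of_mul_mul_eq_zero (Ψ.smul_rootVector_mul_self W α t)
    (Ψ.smul_rootVector_mul_self W β u) (Ψ.smul_rootVector_mul_mul_eq_zero W hαβα t u)
  rw [Ψ.lie_smul_rootVector W h, Ψ.smul_rootVector_mul_mul W hβαβ,
    mul_right_comm (c' : R)] at hconj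
  refine Subtype.ext (Units.ext ?_)
  simpa only [Subgroup.coe_mul, Units.val_mul, coe_xRoot, neg_mul, neg_smul,
    ← sub_eq_add_neg] using hconj

theorem conj_xRoot_of_mul_mul_left {c' : ℤ}
    (hβαβ : Ψ.rootVector W R β * Ψ.rootVector W R α * Ψ.rootVector W R β = 0)
    (hαβα : Ψ.rootVector W R α * Ψ.rootVector W R β * Ψ.rootVector W R α =
      c' • Ψ.rootVector W R δ) (t u : R) :
    Ψ.xRoot W R β (-u) * Ψ.xRoot W R α t * Ψ.xRoot W R β u =
      Ψ.xRoot W R α t * Ψ.xRoot W R γ (c * t * u) * Ψ.xRoot W R δ (c' * t ^ 2 * u) := by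
  have hconj := conj_one_add_of_mul_mul_eq_zero' (Ψ.smul_rootVector_mul_self W α t)
    (Ψ.smul_rootVector_mul_self W β u) (Ψ.smul_rootVector_mul_mul_eq_zero W hβαβ u t)
  rw [Ψ.lie_smul_rootVector W h, Ψ.smul_rootVector_mul_mul W hαβα] at hconj
  refine Subtype.ext (Units.ext ?_)
  simpa only [Subgroup.coe_mul, Units.val_mul, coe_xRoot, neg_smul, ← sub_eq_add_neg] using hconj

theorem pairwise_commute_xRoot {c' : ℤ}
    (hαβα : Ψ.rootVector W R α * Ψ.rootVector W R β * Ψ.rootVector W R α = 0)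
    (hβαβ : Ψ.rootVector W R β * Ψ.rootVector W R α * Ψ.rootVector W R β =
      c' • Ψ.rootVector W R δ) (t u : R) :
    Commute (Ψ.xRoot W R α t) (Ψ.xRoot W R γ (c * t * u)) ∧
      Commute (Ψ.xRoot W R α t) (Ψ.xRoot W R δ (-c' * t * u ^ 2)) ∧
      Commute (Ψ.xRoot W R γ (c * t * u)) (Ψ.xRoot W R δ (-c' * t * u ^ 2)) := by
  have h₀ := Ψ.smul_rootVector_mul_mul_eq_zero W hαβα t u
  simp only [commute_xRoot_iff, neg_mul, neg_smul, Commute.neg_right_iff]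
  rw [mul_right_comm (c' : R), ← Ψ.lie_smul_rootVector W h,
    ← Ψ.smul_rootVector_mul_mul W hβαβ u t]
  exact ⟨commute_lie_of_mul_mul_eq_zero (Ψ.smul_rootVector_mul_self W α t) h₀,
    commute_mul_mul_of_mul_mul_eq_zero h₀,
    commute_lie_mul_mul (Ψ.smul_rootVector_mul_self W β u) h₀⟩

end RootElements

end MinusculeSet

end MinusculeChevalley

end

open MinusculeChevalley in
theorem proposition3p2_general {ι E N : Type*} [Finite ι] [AddCommGroup E] [Module ℚ E]
    [AddCommGroup N] [Module ℚ N] (P : RootPairing ι ℚ E N) [P.IsRootSystem]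
    [P.IsCrystallographic] [P.IsReduced] [P.IsIrreducible] (b : P.Base)
    (Ψ : MinusculeSet b) (W : RootWords b) (α β : ι) (hne : P.root β ≠ -P.root α) :
    (P.root α + P.root β ∉ Set.range P.root →
      ∀ (R : Type*) [CommRing R] (t u : R),
        Ψ.xRoot W R α t * Ψ.xRoot W R β u = Ψ.xRoot W R β u * Ψ.xRoot W R α t) ∧
    (∀ γ : ι, P.root γ = P.root α + P.root β →
      ∃ c : ℤ, c ∈ ({1, -1, 2, -2} : Set ℤ) ∧
        (∀ z : ℂ, ⁅Ψ.rootVector W ℂ α, Ψ.rootVector W ℂ β⁆ = z • Ψ.rootVector W ℂ γ ↔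
          z = (c : ℂ)) ∧
        (2 • P.root α + P.root β ∉ Set.range P.root →
          P.root α + 2 • P.root β ∉ Set.range P.root →
          ∀ (R : Type*) [CommRing R] (t u : R),
            Ψ.xRoot W R β (-u) * Ψ.xRoot W R α t * Ψ.xRoot W R β u =
              Ψ.xRoot W R α t * Ψ.xRoot W R γ (c * t * u)) ∧
        (2 • P.root α + P.root β ∉ Set.range P.root →
          ∀ δ : ι, P.root δ = P.root α + 2 • P.root β →
          ∃ c' : ℤ, c' ∈ ({1, -1} : Set ℤ) ∧
            (∀ z : ℂ, Ψ.rootVector W ℂ β * Ψ.rootVector W ℂ α * Ψ.rootVector W ℂ β =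
              z • Ψ.rootVector W ℂ δ ↔ z = (c' : ℂ)) ∧
            ∀ (R : Type*) [CommRing R] (t u : R),
              Ψ.xRoot W R β (-u) * Ψ.xRoot W R α t * Ψ.xRoot W R β u =
                Ψ.xRoot W R α t * Ψ.xRoot W R γ (c * t * u) * Ψ.xRoot W R δ (-c' * t * u ^ 2) ∧
              Commute (Ψ.xRoot W R α t) (Ψ.xRoot W R γ (c * t * u)) ∧
              Commute (Ψ.xRoot W R α t) (Ψ.xRoot W R δ (-c' * t * u ^ 2)) ∧
              Commute (Ψ.xRoot W R γ (c * t * u)) (Ψ.xRoot W R δ (-c' * t * u ^ 2))) ∧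
        (∀ δ : ι, P.root δ = 2 • P.root α + P.root β →
          P.root α + 2 • P.root β ∉ Set.range P.root ∧
          ∃ c'' : ℤ, c'' ∈ ({1, -1} : Set ℤ) ∧
            (∀ z : ℂ, Ψ.rootVector W ℂ α * Ψ.rootVector W ℂ β * Ψ.rootVector W ℂ α =
              z • Ψ.rootVector W ℂ δ ↔ z = (c'' : ℂ)) ∧
            ∀ (R : Type*) [CommRing R] (t u : R),
              Ψ.xRoot W R β (-u) * Ψ.xRoot W R α t * Ψ.xRoot W R β u =
                Ψ.xRoot W R α t * Ψ.xRoot W R γ (c * t * u) *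
                  Ψ.xRoot W R δ (c'' * t ^ 2 * u))) := by
  refine ⟨fun h R _ => Ψ.commute_xRoot W (Ψ.lie_rootVector_eq_zero W R hne h), fun γ hγ => ?_⟩
  have hγ' := hγ.trans (add_comm _ _)
  obtain ⟨c, hc, h⟩ := Ψ.exists_lie_eq_smul W hγ
  refine ⟨c, hc, Ψ.eq_smul_rootVector_iff W (Ψ.lie_rootVector_eq_of_rat ℂ h),
    fun h₂ h₂' R _ => ?_, fun h₂ δ hδ => ?_, fun δ hδ => ?_⟩
  · exact Ψ.conj_xRoot W (Ψ.lie_rootVector_eq_of_rat R h)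
      (Ψ.mul_rootVector_mul_eq_zero_of_notMem W R hγ h₂)
      (Ψ.mul_rootVector_mul_eq_zero_of_notMem W R hγ' (by rwa [add_comm]))
  · obtain ⟨c', hc', h'⟩ := Ψ.exists_mul_rootVector_mul_eq_smul W hγ' (hδ.trans (add_comm _ _))
    refine ⟨c', hc', Ψ.eq_smul_rootVector_iff W (Ψ.mul_rootVector_mul_eq_of_rat ℂ h'),
      fun R _ t u => ?_⟩
    have h₀ := Ψ.mul_rootVector_mul_eq_zero_of_notMem W R hγ h₂
    have hR := Ψ.lie_rootVector_eq_of_rat R h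
    have hR' := Ψ.mul_rootVector_mul_eq_of_rat R h'
    exact ⟨Ψ.conj_xRoot_of_mul_mul_right W hR h₀ hR' t u, Ψ.pairwise_commute_xRoot W hR h₀ hR' t u⟩
  · have h₂ := Ψ.add_two_nsmul_root_notMem hγ hδ
    obtain ⟨c', hc', h'⟩ := Ψ.exists_mul_rootVector_mul_eq_smul W hγ hδ
    exact ⟨h₂, c', hc', Ψ.eq_smul_rootVector_iff W (Ψ.mul_rootVector_mul_eq_of_rat ℂ h'),
      fun R _ => Ψ.conj_xRoot_of_mul_mul_left W (Ψ.lie_rootVector_eq_of_rat R h)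
        (Ψ.mul_rootVector_mul_eq_zero_of_notMem W R hγ' (by rwa [add_comm]))
        (Ψ.mul_rootVector_mul_eq_of_rat R h')⟩

open MinusculeChevalley in
theorem proposition3p2 {ι E N : Type*} [Finite ι] [AddCommGroup E] [Module ℚ E]
    [AddCommGroup N] [Module ℚ N] (P : RootPairing ι ℚ E N) [P.IsRootSystem]
    [P.IsCrystallographic] [P.IsReduced] [P.IsIrreducible] (b : P.Base)
    (Ψ : MinusculeSet b) (W : RootWords b) (α β : ι) (hα : b.IsPos α) (hβ : b.IsPos β)
    (hne : P.root β ≠ P.root α) (hne' : P.root β ≠ -P.root α) :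
    -- the case `α + β ∉ Φ`
    (P.root α + P.root β ∉ Set.range P.root →
      ∀ (R : Type*) [CommRing R] (t u : R),
        Ψ.xRoot W R α t * Ψ.xRoot W R β u = Ψ.xRoot W R β u * Ψ.xRoot W R α t) ∧
    -- the case `α + β = γ ∈ Φ`
    (∀ γ : ι, P.root γ = P.root α + P.root β →
      -- `c` is the unique scalar with `[𝐞_α, 𝐞_β] = c 𝐞_{α+β}` over `ℂ`
      ∃ c : ℤ, c ∈ ({1, -1, 2, -2} : Set ℤ) ∧
        (∀ z : ℂ, ⁅Ψ.rootVector W ℂ α, Ψ.rootVector W ℂ β⁆ = z • Ψ.rootVector W ℂ γ ↔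
          z = (c : ℂ)) ∧
        -- (a)
        (2 • P.root α + P.root β ∉ Set.range P.root →
          P.root α + 2 • P.root β ∉ Set.range P.root →
          ∀ (R : Type*) [CommRing R] (t u : R),
            Ψ.xRoot W R β (-u) * Ψ.xRoot W R α t * Ψ.xRoot W R β u =
              Ψ.xRoot W R α t * Ψ.xRoot W R γ (c * t * u)) ∧
        -- (b), with `α + 2β = δ ∈ Φ`
        (2 • P.root α + P.root β ∉ Set.range P.root →
          ∀ δ : ι, P.root δ = P.root α + 2 • P.root β →
          ∃ c' : ℤ, c' ∈ ({1, -1} : Set ℤ) ∧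
            (∀ z : ℂ, Ψ.rootVector W ℂ β * Ψ.rootVector W ℂ α * Ψ.rootVector W ℂ β =
              z • Ψ.rootVector W ℂ δ ↔ z = (c' : ℂ)) ∧
            ∀ (R : Type*) [CommRing R] (t u : R),
              Ψ.xRoot W R β (-u) * Ψ.xRoot W R α t * Ψ.xRoot W R β u =
                Ψ.xRoot W R α t * Ψ.xRoot W R γ (c * t * u) * Ψ.xRoot W R δ (-c' * t * u ^ 2) ∧
              Commute (Ψ.xRoot W R α t) (Ψ.xRoot W R γ (c * t * u)) ∧
              Commute (Ψ.xRoot W R α t) (Ψ.xRoot W R δ (-c' * t * u ^ 2)) ∧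
              Commute (Ψ.xRoot W R γ (c * t * u)) (Ψ.xRoot W R δ (-c' * t * u ^ 2))) ∧
        -- (c), with `2α + β = δ ∈ Φ`
        (∀ δ : ι, P.root δ = 2 • P.root α + P.root β →
          P.root α + 2 • P.root β ∉ Set.range P.root ∧
          ∃ c'' : ℤ, c'' ∈ ({1, -1} : Set ℤ) ∧
            (∀ z : ℂ, Ψ.rootVector W ℂ α * Ψ.rootVector W ℂ β * Ψ.rootVector W ℂ α =
              z • Ψ.rootVector W ℂ δ ↔ z = (c'' : ℂ)) ∧
            ∀ (R : Type*) [CommRing R] (t u : R),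
              Ψ.xRoot W R β (-u) * Ψ.xRoot W R α t * Ψ.xRoot W R β u =
                Ψ.xRoot W R α t * Ψ.xRoot W R γ (c * t * u) *
                  Ψ.xRoot W R δ (c'' * t ^ 2 * u))) := by
  exact proposition3p2_general P b Ψ W α β hne'
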